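/- Consider a Red-Black tree (a binary search tree with distinct keys from a linearly ordered set, with black root and black nil leaves, in which red nodes have black children and all root-to-leaf paths contain the same number of black nodes) whose keys can be accessed only through a comparison procedure $\mathrm{Compare}(a,b)\in\{-1,0,+1\}$, called at unit cost. Every call of it gives a wrong (arbitrary) answer with probability at most $p$, conditionally on all earlier calls and their answers (in particular, the error events may be independent). The walking tree method looks for a key $x$ in a tree $t$ as follows. Every node and every nil leaf $v$ carries bounds $\beta(v)<\gamma(v)$ for the keys below it ($\mp\infty$ at the root; the key of the parent replaces $\gamma$ for a left child and $\beta$ for a right child) and a counter $c(v)$, initially $0$. Each comparison is repeated $r$ times and the most frequent answer is taken. The walk starts at the root. At a node $v$ with $c(v)=0$ it tests $\beta(v)<x<\gamma(v)$; if the test fails, it goes to the parent (or stays, at the root); otherwise it tests whether $v$ is the target (the key of $v$ equals $x$, or $v$ is a nil leaf and $\beta(v)<x<\gamma(v)$), sets $c(v)=1$ if so, and otherwise goes to the child indicated by comparing $x$ with the key of $v$ (or stays, at a nil leaf). At a node with $c(v)>0$ it tests whether $v$ is the target, and increases $c(v)$ by $1$ if so and decreases it by $1$ if not. It stops after $c\,(2d+\lceil\log(1/\varepsilon)\rceil)$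 steps, where $d$ is the depth of the leftmost nil leaf of $t$ (which is computed first, and lies between half the height of $t$ and the height). Searching returns the node where the walk stops; adding puts $x$ there if it is a nil leaf, and removing removes the node there if it has a key, followed by the usual Red-Black rebalancing, which uses no comparisons. The running time counts the calls of the comparison procedure and the elementary operations. Let $0<\delta<1/2$. There are natural numbers $r$ and $c$, depending only on $\delta$, with the following properties for all $p<1/2-\delta$. (a) There is a constant $C$, depending only on $\delta$, such that for every comparison procedure as above, every Red-Black tree $t$ with $n$ nodes, every key $x$ and every $0<\varepsilon\le 1/2$, each of the operations of searching $x$ in $t$, adding $x$ to $t$ and removing $x$ from $t$ with the walking tree always takes time at most $C\log(\max(n,1)/\varepsilon)$, and its result is correct with probability at least $1-\varepsilon$. Here a correct result is: for searching, a node of $t$ with key $x$, or a nil leaf of $t$ if $x$ is not in $t$; for adding, a Red-Black tree with the keys of $t$ and $x$; for removing, a Red-Black tree with the keys of $t$ other than $x$. (b) For every real polynomial $P$ there is a constant $C$, depending only on $\delta$ and $P$, such that for every such tree with $n\ge 2$ nodes and $P(n)\ge 2$, with $\varepsilon=1/P(n)$, each of the three operations always takes time at most $C\log n$ and has error probability at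 most $1/P(n)$. -/

import Mathlib

/-!
Noisy red-black trees and the walking tree.  Coloured binary trees `RBTree.RBNode`, the paths
`RBTree.RBNode.Path` from a node up to the root and the constant-time local rebalancing functions
`balance1`, `balance2`, `balLeft`, `balRight` are those of Batteries.
-/

universe u v w

namespace NoisyTree

open RBTree RBTree.RBNode RBTree.RBColor

/-! ### Programs with noisy comparisons and a step count -/

/-- A program that has access to keys of type `K` only through calls of a (noisy) comparison.
`step` marks one unit of time.  Between two consecutive marks (of either kind) every program below
does only a bounded number of elementary operations: no recursive call is left unmarked. -/
inductive Prog (K : Type u) (α : Type v) : Type (max u v)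
  /-- stop with a result -/
  | ret (a : α) : Prog K α
  /-- spend one unit of time -/
  | step (next : Prog K α) : Prog K α
  /-- call the comparison for `a` and `b`, at unit cost, and go on according to its answer -/
  | cmp (a b : K) (next : Ordering → Prog K α) : Prog K α

namespace Prog

/-- Sequential composition. -/
def bind {K : Type u} {α : Type v} {β : Type w} : Prog K α → (α → Prog K β) → Prog K β
  | ret a, f => f a
  | step q, f => step (q.bind f)
  | cmp a b next, f => cmp a b fun o => (next o).bind f

end Prog

/-- A comparison procedure on a linear order whose every call errs with probability at most `p`.
The answer to a call may depend in an arbitrary way on the earlier calls and their answers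
(`past`, latest first), but conditionally on them the probability of a wrong answer is at most `p`.
The wrong answer itself is arbitrary.  In particular this comprises comparison procedures with
independent error events. -/
structure NoisyCompare (K : Type u) [LinearOrder K] (p : ℝ) where
  /-- the law of the answer to a call -/
  answer : List (K × K × Ordering) → K → K → PMF Ordering
  error_le : ∀ past a b,
    (answer past a b).toOuterMeasure {o | o ≠ compare a b} ≤ ENNReal.ofReal p

/-- The joint law of the result and the running time of a program started after the calls `past`. -/
noncomputable def Prog.run {K : Type u} [LinearOrder K] {p : ℝ} (O : NoisyCompare K p)
    {α : Type v} : Prog K α → List (K × K × Ordering) → PMF (α × ℕ)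
  | .ret a, _ => PMF.pure (a, 0)
  | .step q, past => (q.run O past).map fun z => (z.1, z.2 + 1)
  | .cmp a b next, past => (O.answer past a b).bind fun o =>
      ((next o).run O ((a, b, o) :: past)).map fun z => (z.1, z.2 + 1)

/-- The program `q` always stops within time `T`, and the probability that its result is not
`good` is at most `ε`. -/
def RunsWithin {K : Type u} [LinearOrder K] {p : ℝ} (O : NoisyCompare K p) {α : Type v}
    (q : Prog K α) (T ε : ℝ) (good : α → Prop) : Prop :=
  (∀ z ∈ (q.run O []).support, (z.2 : ℝ) ≤ T) ∧
    (q.run O []).toOuterMeasure {z | ¬ good z.1} ≤ ENNReal.ofReal ε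

/-! ### Red-black trees -/

/-- Red-black trees: binary search trees with distinct keys, whose root and whose `nil` leaves are
black, in which red nodes have black children, and in which all paths from the root to a `nil`
leaf have the same number of black nodes. -/
def IsRedBlack {K : Type u} [LinearOrder K] (t : RBNode K) : Prop :=
  t.Ordered compare ∧ ∃ n, t.Balanced black n

/-! ### The walking tree -/

/-- The way from a node of the walking tree up to the root.  The nodes of the walking tree
correspond to the nodes and to the `nil` leaves of the tree; with each of them there are stored
a lower bound `lo` (`none` means `-∞`) and an upper bound `hi` (`none` means `+∞`) for the keys
below it.  Here `lo`, `hi` are the bounds of the parent, `v` is its key and `l` or `r` is its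
other subtree. -/
inductive Trail (K : Type u) : Type u
  | root : Trail K
  | left (c : RBColor) (parent : Trail K) (lo hi : Option K) (v : K) (r : RBNode K) : Trail K
  | right (c : RBColor) (l : RBNode K) (v : K) (lo hi : Option K) (parent : Trail K) : Trail K

/-- The state of the walk: the current node (given by the subtree `focus` at it and the way
`trail` up), its bounds, and its counter.  All other counters are zero, since the walk leaves a
node only if its counter is zero. -/
structure Walker (K : Type u) where
  focus : RBNode K
  lo : Option K
  hi : Option K
  trail : Trail K
  count : ℕ

/-- The walk starts at the root. -/
def Walker.start {K : Type u} (t : RBNode K) : Walker K := ⟨t, none, none, .root, 0⟩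

/-- Go to the parent; stay at the root. -/
def Walker.goUp {K : Type u} (s : Walker K) : Walker K :=
  match s.trail with
  | .root => s
  | .left c parent lo hi v r => ⟨node c s.focus v r, lo, hi, parent, s.count⟩
  | .right c l v lo hi parent => ⟨node c l v s.focus, lo, hi, parent, s.count⟩

/-- Go to the left child; stay at a `nil` leaf. -/
def Walker.goLeft {K : Type u} (s : Walker K) : Walker K :=
  match s.focus with
  | nil => s
  | node c l v r => ⟨l, s.lo, some v, .left c s.trail s.lo s.hi v r, s.count⟩

/-- Go to the right child; stay at a `nil` leaf. -/
def Walker.goRight {K : Type u} (s : Walker K) : Walker K :=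
  match s.focus with
  | nil => s
  | node c l v r => ⟨r, some v, s.hi, .right c l v s.lo s.hi s.trail, s.count⟩

/-- The answer with the largest number of votes. -/
def mostFrequent (nlt neq ngt : ℕ) : Ordering :=
  if neq ≤ nlt ∧ ngt ≤ nlt then .lt else if ngt ≤ neq then .eq else .gt

/-- Compare `a` and `b` `r` more times, adding the answers to the votes counted so far, and return
the most frequent answer. -/
def vote {K : Type u} (a b : K) : (r nlt neq ngt : ℕ) → Prog K Ordering
  | 0, nlt, neq, ngt => .step (.ret (mostFrequent nlt neq ngt))
  | r + 1, nlt, neq, ngt => .cmp a b fun o =>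
      match o with
      | .lt => vote a b r (nlt + 1) neq ngt
      | .eq => vote a b r nlt (neq + 1) ngt
      | .gt => vote a b r nlt neq (ngt + 1)

/-- The comparison, with its success probability boosted by `r` repetitions. -/
def boosted {K : Type u} (r : ℕ) (a b : K) : Prog K Ordering := vote a b r 0 0 0

/-- Is `a < b`?  (`none` for `a` means `-∞`, which needs no comparison.) -/
def isAbove {K : Type u} (r : ℕ) (a : Option K) (b : K) : Prog K Bool :=
  match a with
  | none => .ret true
  | some a => (boosted r a b).bind fun o => .ret (o == .lt)

/-- Is `a < b`?  (`none` for `b` means `+∞`, which needs no comparison.) -/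
def isBelow {K : Type u} (r : ℕ) (a : K) (b : Option K) : Prog K Bool :=
  match b with
  | none => .ret true
  | some b => (boosted r a b).bind fun o => .ret (o == .lt)

/-- Does `x` lie strictly between the bounds of the current node? -/
def isNodeCorrect {K : Type u} (r : ℕ) (x : K) (s : Walker K) : Prog K Bool :=
  (isAbove r s.lo x).bind fun b₁ => (isBelow r x s.hi).bind fun b₂ => .ret (b₁ && b₂)

/-- Is the current node the last one to be visited?  A node with a key is if its key is `x`;
a `nil` leaf is if `x` lies between its bounds, so that `x` is missing and belongs there. -/
def isTheTarget {K : Type u} (r : ℕ) (x : K) (s : Walker K) : Prog K Bool :=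
  match s.focus with
  | nil => isNodeCorrect r x s
  | node _ _ v _ => (boosted r v x).bind fun o => .ret (o == .eq)

/-- Go to the child to which the comparison of the key of the current node with `x` points
(a `nil` leaf has no child to go to). -/
def selectChild {K : Type u} (r : ℕ) (x : K) (s : Walker K) : Prog K (Walker K) :=
  match s.focus with
  | nil => .ret s
  | node _ _ v _ => (boosted r v x).bind fun o => .ret (if o = .lt then s.goRight else s.goLeft)

/-- One step of the walk. -/
def oneStep {K : Type u} (r : ℕ) (x : K) (s : Walker K) : Prog K (Walker K) :=
  .step <|
    if s.count = 0 then
      (isNodeCorrect r x s).bind fun correct =>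
        if correct then
          (isTheTarget r x s).bind fun target =>
            if target then .ret { s with count := 1 } else selectChild r x s
        else .ret s.goUp
    else
      (isTheTarget r x s).bind fun target =>
        if target then .ret { s with count := s.count + 1 }
        else .ret { s with count := s.count - 1 }

/-- The walk for a given number of steps. -/
def steps {K : Type u} (r : ℕ) (x : K) : ℕ → Walker K → Prog K (Walker K)
  | 0, s => .ret s
  | m + 1, s => (oneStep r x s).bind fun s' => steps r x m s'

/-- The path in the original tree from the current node up to the root. -/
def Trail.toPath {K : Type u} : Trail K → Prog K (RBNode.Path K)
  | .root => .step (.ret .root)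
  | .left c parent _ _ v r => .step (parent.toPath.bind fun q => .ret (.left c q v r))
  | .right c l v _ _ parent => .step (parent.toPath.bind fun q => .ret (.right c l v q))

/-- The depth of the leftmost `nil` leaf (added to `d`).  In a red-black tree of height `h` it is
between `h / 2` and `h`. -/
def leftDepth {K : Type u} : RBNode K → ℕ → Prog K ℕ
  | nil, d => .step (.ret d)
  | node _ l _ _, d => .step (leftDepth l (d + 1))

/-- The walking algorithm: walk in `t` for `c * (2 * d + L)` steps with `r`-fold repetition of
comparisons, where `d` is the depth of the leftmost `nil` leaf, and return the subtree at the
node where the walk stops, together with the path to it. -/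
def walk {K : Type u} (r c L : ℕ) (t : RBNode K) (x : K) :
    Prog K (RBNode K × RBNode.Path K) :=
  (leftDepth t 0).bind fun d =>
    (steps r x (c * (2 * d + L)) (Walker.start t)).bind fun s =>
      s.trail.toPath.bind fun path => .ret (s.focus, path)

/-! ### Actions on the tree, without comparisons -/

/-- The whole tree, from the subtree at a node and the path to it. -/
def fill {K : Type u} : RBNode.Path K → RBNode K → Prog K (RBNode K)
  | .root, t => .step (.ret t)
  | .left c parent v r, l => .step (fill parent (node c l v r))
  | .right c l v parent, r => .step (fill parent (node c l v r))

/-- Rebalancing after an insertion, on the way up to the root. -/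
def rebalanceInsert {K : Type u} : RBNode.Path K → RBNode K → Prog K (RBNode K)
  | .root, t => .step (.ret t.setBlack)
  | .left red parent v r, l => .step (rebalanceInsert parent (node red l v r))
  | .right red l v parent, r => .step (rebalanceInsert parent (node red l v r))
  | .left black parent v r, l => .step (rebalanceInsert parent (balance1 l v r))
  | .right black l v parent, r => .step (rebalanceInsert parent (balance2 l v r))

/-- Joins the two subtrees of a removed node. -/
def join {K : Type u} : RBNode K → RBNode K → Prog K (RBNode K)
  | nil, t => .step (.ret t)
  | t, nil => .step (.ret t)
  | node red a x b, node red c y d => .step <| (join b c).bind fun m =>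
      match m with
      | node red b' z c' => .ret (node red (node red a x b') z (node red c' y d))
      | m => .ret (node red a x (node red m y d))
  | node black a x b, node black c y d => .step <| (join b c).bind fun m =>
      match m with
      | node red b' z c' => .ret (node red (node black a x b') z (node black c' y d))
      | m => .ret (balLeft a x (node black m y d))
  | node black a x b, node red c y d => .step <|
      (join (node black a x b) c).bind fun m => .ret (node red m y d)
  | node red a x b, node black c y d => .step <|
      (join b (node black c y d)).bind fun m => .ret (node red a x m)
termination_by s t => s.size + t.size
decreasing_by all_goals simp only [RBNode.size]; omega

/-- Rebalancing after a removal, on the way up to the root; the colour is the one that the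
root of the current subtree had before the removal. -/
def rebalanceDelete {K : Type u} : RBNode.Path K → RBNode K → RBColor → Prog K (RBNode K)
  | .root, t, _ => .step (.ret t.setBlack)
  | .left c parent v r, l, red => .step (rebalanceDelete parent (node red l v r) c)
  | .right c l v parent, r, red => .step (rebalanceDelete parent (node red l v r) c)
  | .left c parent v r, l, black => .step (rebalanceDelete parent (balLeft l v r) c)
  | .right c l v parent, r, black => .step (rebalanceDelete parent (balRight l v r) c)

/-! ### The operations -/

/-- Searching: returns the subtree where the walk stops and the path to it. -/
def search {K : Type u} (r c L : ℕ) (t : RBNode K) (x : K) :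
    Prog K (RBNode K × RBNode.Path K) :=
  walk r c L t x

/-- Adding: if the walk stops at a `nil` leaf, put `x` there and rebalance. -/
def insert {K : Type u} (r c L : ℕ) (t : RBNode K) (x : K) : Prog K (RBNode K) :=
  (walk r c L t x).bind fun z =>
    match z with
    | (nil, path) => rebalanceInsert path (node red nil x nil)
    | (node col a v b, path) => fill path (node col a v b)

/-- Removing: if the walk stops at a node with a key, remove this node and rebalance. -/
def delete {K : Type u} (r c L : ℕ) (t : RBNode K) (x : K) : Prog K (RBNode K) :=
  (walk r c L t x).bind fun z =>
    match z with
    | (nil, path) => fill path nil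
    | (node col a _ b, path) => (join a b).bind fun m => rebalanceDelete path m col

/-- The correct results of searching `x` in `t`: a node of `t` with the key `x`, or a `nil` leaf
of `t` if `x` is not in `t`. -/
def IsSearchResult {K : Type u} (t : RBNode K) (x : K) (z : RBNode K × RBNode.Path K) : Prop :=
  z.2.fill z.1 = t ∧
    match z.1 with
    | nil => x ∉ t
    | node _ _ v _ => v = x

/-- The correct results of adding `x` to `t`. -/
def IsInsertResult {K : Type u} [LinearOrder K] (t : RBNode K) (x : K) (t' : RBNode K) : Prop :=
  IsRedBlack t' ∧ ∀ y, y ∈ t' ↔ y ∈ t ∨ y = x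

/-- The correct results of removing `x` from `t`. -/
def IsDeleteResult {K : Type u} [LinearOrder K] (t : RBNode K) (x : K) (t' : RBNode K) : Prop :=
  IsRedBlack t' ∧ ∀ y, y ∈ t' ↔ y ∈ t ∧ y ≠ x

/-- Searching `x` in `t`, adding `x` to `t` and removing `x` from `t` with the walking tree, with
`L = ⌈log (1 / ε)⌉`, each take time at most `T` and have error probability at most `ε`. -/
def OperationsWithin {K : Type u} [LinearOrder K] {p : ℝ} (O : NoisyCompare K p) (r c : ℕ)
    (t : RBNode K) (x : K) (T ε : ℝ) : Prop :=
  RunsWithin O (search r c ⌈Real.log (1 / ε)⌉₊ t x) T ε (IsSearchResult t x) ∧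
  RunsWithin O (insert r c ⌈Real.log (1 / ε)⌉₊ t x) T ε (IsInsertResult t x) ∧
  RunsWithin O (delete r c ⌈Real.log (1 / ε)⌉₊ t x) T ε (IsDeleteResult t x)

end NoisyTree

/-!
The walk of the search for `x` is compared with an error-free one by a potential: the distance in
the walking tree from the current node to the target (the node with key `x`, or the `nil` leaf
where `x` belongs), plus the counter, and minus the counter at the target itself.  A step without
errors decreases the potential by one (`oneStep_errs`), and an arbitrary step increases it by at
most one (`oneStep_ensures`).  For both it matters that the bounds of a node contain `x` exactly if
the target is at or below the node, which is read off from the order of the tree (`Trail.Fits`,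
`Trail.dist`).

A majority vote over `r` repetitions of a comparison is wrong with probability at most
`(1 - 2 * δ ^ 2) ^ r` (`vote_errs`); the errors need not be independent, as the bound is a bound on
the mean of an exponential of the votes that is multiplied by a factor less than one in each call,
whatever happened before.  Thus `r` can be chosen such that a step of the walk, which makes at most
five votes, goes wrong with probability at most `1 / 16`.  Then each step at least halves the mean
of `4 ^ potential` (`steps_errs`).  At the start the potential is at most the depth of the tree,
which is at most `2 * d` for a red-black tree, `d` being the depth of the leftmost leaf; so after
`2 * (2 * d + L)` steps the mean is at most `4⁻¹ ^ L ≤ ε`, and this bounds the probability that the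
potential is positive, that is, that the walk does not end at the target (`walk_errs`).

If it does, the tree surgery is that of Batteries' zippers, and the results on these give the
correctness (`insert_errs`, `delete_errs`).  All loops outside the walk run along paths of the tree,
so the running time is bounded by a multiple of depth plus `L`, hence of `log (max n 1 / ε)`
(`time_le_mul_log`).  The second part is the case `ε = 1 / P n`, where `P n ≤ n ^ k`.

Programs are treated by two notions that are compatible with sequential composition: `Prog.Ensures`,
for what holds whatever the answers are, and `Prog.Errs`, for a bound on the failure probability
that is uniform in the calls made before.
-/

namespace NoisyTree

open RBTree RBTree.RBNode RBTree.RBColor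

/-! ### Reasoning about programs -/

namespace Prog

/-- The program `q` satisfies the postcondition `Q` on its result and its running time, whatever
the answers of the comparison procedure are. -/
def Ensures {K : Type u} {α : Type v} : Prog K α → (α → ℕ → Prop) → Prop
  | .ret a, Q => Q a 0
  | .step q, Q => q.Ensures fun a n => Q a (n + 1)
  | .cmp _ _ next, Q => ∀ o, (next o).Ensures fun a n => Q a (n + 1)

theorem Ensures.mono {K : Type u} {α : Type v} {q : Prog K α} {Q Q' : α → ℕ → Prop}
    (h : q.Ensures Q) (hQ : ∀ a n, Q a n → Q' a n) : q.Ensures Q' := by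
  induction q generalizing Q Q' with
  | ret a => exact hQ _ _ h
  | step q ih => exact ih h fun a n => hQ a (n + 1)
  | cmp a b next ih => exact fun o => ih o (h o) fun a n => hQ a (n + 1)

theorem Ensures.bind {K : Type u} {α : Type v} {β : Type w} {q : Prog K α} {k : α → Prog K β}
    {Q : α → ℕ → Prop} {R : β → ℕ → Prop} (h : q.Ensures Q)
    (hk : ∀ a n, Q a n → (k a).Ensures fun b m => R b (n + m)) : (q.bind k).Ensures R := by
  induction q generalizing Q R with
  | ret a => simpa [Prog.bind] using hk a 0 h
  | step q ih =>
    refine ih h fun a n hn => (hk a (n + 1) hn).mono fun b m hm => ?_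
    simpa only [Nat.add_right_comm] using hm
  | cmp a b next ih =>
    refine fun o => ih o (h o) fun a n hn => (hk a (n + 1) hn).mono fun b m hm => ?_
    simpa only [Nat.add_right_comm] using hm

theorem ensures_of_forall {K : Type u} {α : Type v} {q : Prog K α} {P : α → Prop} (h : ∀ a, P a) :
    q.Ensures fun a _ => P a := by
  induction q with
  | ret a => exact h a
  | step q ih => exact ih
  | cmp a b next ih => exact ih

/-- The mean of `f` over the results of a program started after the calls `past`. -/
noncomputable def expect {K : Type u} [LinearOrder K] {p : ℝ} (O : NoisyCompare K p)
    {α : Type v} : Prog K α → List (K × K × Ordering) → (α → ℝ) → ℝ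
  | .ret a, _, f => f a
  | .step q, past, f => q.expect O past f
  | .cmp a b next, past, f =>
      ∑ o, (O.answer past a b o).toReal * (next o).expect O ((a, b, o) :: past) f

variable {K : Type u} [LinearOrder K] {p : ℝ} {O : NoisyCompare K p} {α : Type v} {β : Type w}

theorem _root_.PMF.sum_toReal_eq_one {ι : Type*} [Fintype ι] (μ : PMF ι) :
    ∑ i, (μ i).toReal = 1 := by
  rw [← ENNReal.toReal_sum fun i _ => μ.apply_ne_top i, ← tsum_fintype (L := .unconditional _),
    μ.tsum_coe, ENNReal.toReal_one]

theorem Ensures.of_mem_support {q : Prog K α} {Q : α → ℕ → Prop} (h : q.Ensures Q)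
    {past : List (K × K × Ordering)} {z : α × ℕ} (hz : z ∈ (q.run O past).support) :
    Q z.1 z.2 := by
  induction q generalizing Q past z with
  | ret a =>
    simp only [run, PMF.support_pure, Set.mem_singleton_iff] at hz
    subst hz; exact h
  | step q ih =>
    simp only [run, PMF.support_map, Set.mem_image] at hz
    obtain ⟨y, hy, rfl⟩ := hz
    exact ih h hy
  | cmp a b next ih =>
    simp only [run, PMF.mem_support_bind_iff, PMF.support_map, Set.mem_image] at hz
    obtain ⟨o, -, y, hy, rfl⟩ := hz
    exact ih o (h o) hy

theorem expect_mono_of_ensures {q : Prog K α} {f g : α → ℝ}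
    (h : q.Ensures fun a _ => f a ≤ g a) (past : List (K × K × Ordering)) :
    q.expect O past f ≤ q.expect O past g := by
  induction q generalizing past with
  | ret a => exact h
  | step q ih => exact ih h past
  | cmp a b next ih =>
    exact Finset.sum_le_sum fun o _ => mul_le_mul_of_nonneg_left (ih o (h o) _) ENNReal.toReal_nonneg

theorem expect_mono {q : Prog K α} {f g : α → ℝ} (h : ∀ a, f a ≤ g a)
    (past : List (K × K × Ordering)) : q.expect O past f ≤ q.expect O past g :=
  expect_mono_of_ensures (ensures_of_forall h) past

theorem expect_affine (q : Prog K α) (f : α → ℝ) (c d : ℝ) (past : List (K × K × Ordering)) :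
    q.expect O past (fun a => c + d * f a) = c + d * q.expect O past f := by
  induction q generalizing past with
  | ret a => rfl
  | step q ih => exact ih past
  | cmp a b next ih =>
    simp only [expect, ih, mul_add, Finset.sum_add_distrib, ← Finset.sum_mul,
      PMF.sum_toReal_eq_one, one_mul, Finset.mul_sum]
    congr 1
    exact Finset.sum_congr rfl fun o _ => by ring

theorem expect_const (q : Prog K α) (c : ℝ) (past : List (K × K × Ordering)) :
    q.expect O past (fun _ => c) = c := by
  simpa using q.expect_affine (O := O) (fun _ => 0) c 0 past

theorem expect_bind_le {q : Prog K α} {k : α → Prog K β} {f : β → ℝ} {g : α → ℝ}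
    (h : q.Ensures fun a _ => ∀ past, (k a).expect O past f ≤ g a)
    (past : List (K × K × Ordering)) :
    (q.bind k).expect O past f ≤ q.expect O past g := by
  induction q generalizing past with
  | ret a => exact h past
  | step q ih => exact ih h past
  | cmp a b next ih =>
    exact Finset.sum_le_sum fun o _ => mul_le_mul_of_nonneg_left (ih o (h o) _) ENNReal.toReal_nonneg

open Classical in
/-- The probability that the result of a program is not `good`, as a real number. -/
noncomputable def failure (O : NoisyCompare K p) (q : Prog K α) (past : List (K × K × Ordering))
    (good : α → Prop) : ℝ := q.expect O past fun a => if good a then 0 else 1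

theorem failure_nonneg (q : Prog K α) (past : List (K × K × Ordering)) (good : α → Prop) :
    0 ≤ q.failure O past good := by
  rw [← q.expect_const (O := O) 0 past]
  exact expect_mono (fun a => by split <;> norm_num) past

theorem run_toOuterMeasure (q : Prog K α) (past : List (K × K × Ordering)) (good : α → Prop) :
    (q.run O past).toOuterMeasure {z | ¬ good z.1} = ENNReal.ofReal (q.failure O past good) := by
  classical
  induction q generalizing past with
  | ret a => by_cases h : good a <;> simp [run, failure, expect, PMF.toOuterMeasure_pure_apply, h]
  | step q ih =>
    rw [run, PMF.toOuterMeasure_map_apply]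
    exact ih past
  | cmp a b next ih =>
    have h : (Prog.cmp a b next).failure O past good =
        ∑ o, (O.answer past a b o).toReal * (next o).failure O ((a, b, o) :: past) good := rfl
    rw [run, PMF.toOuterMeasure_bind_apply, tsum_fintype, h, ENNReal.ofReal_sum_of_nonneg
      fun o _ => mul_nonneg ENNReal.toReal_nonneg ((next o).failure_nonneg _ good)]
    refine Finset.sum_congr rfl fun o _ => ?_
    rw [ENNReal.ofReal_mul ENNReal.toReal_nonneg, ENNReal.ofReal_toReal (PMF.apply_ne_top _ _),
      PMF.toOuterMeasure_map_apply]
    exact congrArg _ (ih o _)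

/-- Whatever calls were made before, the result of `q` is not `good` with probability at
most `η`. -/
def Errs (O : NoisyCompare K p) (q : Prog K α) (η : ℝ) (good : α → Prop) : Prop :=
  ∀ past, q.failure O past good ≤ η

theorem Ensures.errs {q : Prog K α} {good : α → Prop} (h : q.Ensures fun a _ => good a) :
    q.Errs O 0 good := fun past => by
  rw [← q.expect_const (O := O) 0 past]
  exact expect_mono_of_ensures (h.mono fun a _ ha => by simp [ha]) past

theorem Errs.mono {q : Prog K α} {η η' : ℝ} {good good' : α → Prop} (h : q.Errs O η good)
    (hη : η ≤ η') (hg : ∀ a, good a → good' a) : q.Errs O η' good' := fun past =>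
  (expect_mono (fun a => by have := hg a; split_ifs <;> simp_all) past).trans ((h past).trans hη)

theorem errs_one (q : Prog K α) (good : α → Prop) : q.Errs O 1 good := fun past => by
  rw [← q.expect_const (O := O) 1 past]
  exact expect_mono (fun a => by split <;> norm_num) past

theorem Errs.and_of_ensures {q : Prog K α} {η : ℝ} {good P : α → Prop} (h : q.Errs O η good)
    (hP : q.Ensures fun a _ => P a) : q.Errs O η fun a => P a ∧ good a := fun past =>
  (expect_mono_of_ensures (hP.mono fun a _ ha => by split_ifs <;> simp_all) past).trans (h past)

theorem failure_bind_le {q : Prog K α} {k : α → Prog K β} {u v : ℝ} {good₁ : α → Prop}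
    {good₂ : β → Prop}
    (h : q.Ensures fun a _ =>
      (good₁ a → (k a).Errs O u good₂) ∧ (¬ good₁ a → (k a).Errs O (u + v) good₂))
    (past : List (K × K × Ordering)) :
    (q.bind k).failure O past good₂ ≤ u + v * q.failure O past good₁ := by
  classical
  rw [failure, failure, ← expect_affine]
  refine expect_bind_le (h.mono fun a _ ha past => ?_) past
  split_ifs with hgood
  · simpa using! ha.1 hgood past
  · simpa using! ha.2 hgood past

theorem Errs.bind {q : Prog K α} {k : α → Prog K β} {η₁ η₂ : ℝ} {good₁ : α → Prop}
    {good₂ : β → Prop} (h₁ : q.Errs O η₁ good₁) (hη₂ : 0 ≤ η₂)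
    (h₂ : ∀ a, good₁ a → (k a).Errs O η₂ good₂) : (q.bind k).Errs O (η₁ + η₂) good₂ := by
  intro past
  have := failure_bind_le (q := q) (v := 1) (ensures_of_forall fun a => ⟨h₂ a, fun _ =>
    ((k a).errs_one good₂).mono (by linarith) fun _ => id⟩) past
  linarith [h₁ past]

end Prog

theorem runsWithin_of_ensures_of_errs {K : Type u} [LinearOrder K] {p : ℝ} {O : NoisyCompare K p}
    {α : Type v} {q : Prog K α} {T ε : ℝ} {good : α → Prop}
    (hT : q.Ensures fun _ n => (n : ℝ) ≤ T) (hε : q.Errs O ε good) : RunsWithin O q T ε good :=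
  ⟨fun _ hz => hT.of_mem_support hz, by
    rw [Prog.run_toOuterMeasure]; exact ENNReal.ofReal_le_ofReal (hε [])⟩

/-! ### Boosting a comparison by a majority vote -/

section Boosting

variable {K : Type u} [LinearOrder K] {p : ℝ} {O : NoisyCompare K p}

/-- The number of votes for the wrong answers minus the number of votes for the right answer,
which is the first argument. -/
def wrongLead : Ordering → (nlt neq ngt : ℕ) → ℤ
  | .lt, nlt, neq, ngt => neq + ngt - nlt
  | .eq, nlt, neq, ngt => nlt + ngt - neq
  | .gt, nlt, neq, ngt => nlt + neq - ngt

theorem mostFrequent_eq_of_wrongLead_neg {o : Ordering} {nlt neq ngt : ℕ}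
    (h : wrongLead o nlt neq ngt < 0) : mostFrequent nlt neq ngt = o := by
  cases o <;> simp only [wrongLead] at h <;> unfold mostFrequent
  · rw [if_pos (by omega)]
  · rw [if_neg (by omega), if_pos (by omega)]
  · rw [if_neg (by omega), if_neg (by omega)]

theorem NoisyCompare.le_answer_compare {δ : ℝ} (hδ : δ < 1 / 2) (hp : p < 1 / 2 - δ)
    (past : List (K × K × Ordering)) (a b : K) :
    1 / 2 + δ ≤ (O.answer past a b (compare a b)).toReal := by
  set μ := O.answer past a b
  have h := O.error_le past a b
  rw [PMF.toOuterMeasure_apply_fintype] at h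
  have h' : ∑ o, {o | o ≠ compare a b}.indicator μ o + μ (compare a b) = 1 := by
    rw [← μ.tsum_coe, tsum_fintype, ← Finset.add_sum_erase _ _ (Finset.mem_univ (compare a b)),
      ← Finset.add_sum_erase _ μ (Finset.mem_univ (compare a b)),
      Set.indicator_of_notMem (by simp), zero_add, add_comm]
    congr 1
    exact Finset.sum_congr rfl fun o ho => Set.indicator_of_mem (Finset.ne_of_mem_erase ho) _
  have h2 : (1 : ENNReal) ≤ ENNReal.ofReal (1 / 2 - δ) + μ (compare a b) := by
    rw [← h']
    exact add_le_add_left (h.trans (ENNReal.ofReal_le_ofReal hp.le)) _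
  have h3 := ENNReal.toReal_mono (ENNReal.add_ne_top.2 ⟨ENNReal.ofReal_ne_top, μ.apply_ne_top _⟩) h2
  rw [ENNReal.toReal_add ENNReal.ofReal_ne_top (μ.apply_ne_top _),
    ENNReal.toReal_ofReal (by linarith), ENNReal.toReal_one] at h3
  linarith

/-- The probability that a vote goes wrong is at most the mean of `(1 + 2 * δ) ^ k`, where `k` is
the final lead of the wrong answers.  Each call multiplies the mean by at most
`(1 / 2 + δ) / (1 + 2 * δ) + (1 / 2 - δ) * (1 + 2 * δ) = 1 - 2 * δ ^ 2`. -/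
theorem vote_errs {δ : ℝ} (hδ₀ : 0 < δ) (hδ : δ < 1 / 2) (hp : p < 1 / 2 - δ) (a b : K)
    (r nlt neq ngt : ℕ) :
    (vote a b r nlt neq ngt).Errs O
      ((1 - 2 * δ ^ 2) ^ r * (1 + 2 * δ) ^ wrongLead (compare a b) nlt neq ngt)
      (· = compare a b) := by
  have hθ : (0 : ℝ) < 1 + 2 * δ := by linarith
  induction r generalizing nlt neq ngt with
  | zero =>
    intro past
    simp only [vote, Prog.failure, Prog.expect, pow_zero, one_mul]
    split_ifs with h
    · positivity
    · refine one_le_zpow₀ (by linarith) ?_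
      by_contra! h'
      exact h (mostFrequent_eq_of_wrongLead_neg h')
  | succ r ih =>
    intro past
    set G := (1 - 2 * δ ^ 2) ^ r * (1 + 2 * δ) ^ wrongLead (compare a b) nlt neq ngt with hG
    have hκ : 0 ≤ 1 - 2 * δ ^ 2 := by nlinarith
    have hG₀ : 0 ≤ G := by positivity
    have hlead : ∀ (o : Ordering) (m₁ m₂ m₃ : ℕ),
        wrongLead (compare a b) m₁ m₂ m₃ =
          wrongLead (compare a b) nlt neq ngt + (if o = compare a b then -1 else 1) →
        (1 - 2 * δ ^ 2) ^ r * (1 + 2 * δ) ^ wrongLead (compare a b) m₁ m₂ m₃ =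
          if o = compare a b then G * (1 + 2 * δ)⁻¹ else G * (1 + 2 * δ) := by
      intro o m₁ m₂ m₃ h
      rw [h, zpow_add₀ hθ.ne', ← mul_assoc, ← hG]
      split_ifs <;> simp
    let next (o : Ordering) : Prog K Ordering := match o with
      | .lt => vote a b r (nlt + 1) neq ngt
      | .eq => vote a b r nlt (neq + 1) ngt
      | .gt => vote a b r nlt neq (ngt + 1)
    have hnext : ∀ o, (next o).failure O ((a, b, o) :: past) (· = compare a b) ≤
        if o = compare a b then G * (1 + 2 * δ)⁻¹ else G * (1 + 2 * δ) := by
      intro o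
      cases o
      all_goals
        refine (ih _ _ _ _).trans_eq (hlead _ _ _ _ ?_)
        cases compare a b <;> simp [wrongLead] <;> ring
    have key : ∀ P : ℝ, 1 / 2 + δ ≤ P →
        P * (G * (1 + 2 * δ)⁻¹) + (1 - P) * (G * (1 + 2 * δ)) ≤ (1 - 2 * δ ^ 2) * G := by
      intro P hP
      have h1 : P * (1 + 2 * δ)⁻¹ + (1 - P) * (1 + 2 * δ) ≤ 1 - 2 * δ ^ 2 := by
        have h2 : (1 + 2 * δ)⁻¹ ≤ 1 := inv_le_one_of_one_le₀ (by linarith)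
        have h3 : (1 / 2 + δ) * (1 + 2 * δ)⁻¹ = 1 / 2 := by field_simp
        nlinarith
      nlinarith
    calc (vote a b (r + 1) nlt neq ngt).failure O past (· = compare a b)
        = ∑ o, (O.answer past a b o).toReal *
            (next o).failure O ((a, b, o) :: past) (· = compare a b) := rfl
      _ ≤ ∑ o, (O.answer past a b o).toReal *
            if o = compare a b then G * (1 + 2 * δ)⁻¹ else G * (1 + 2 * δ) :=
          Finset.sum_le_sum fun o _ => mul_le_mul_of_nonneg_left (hnext o) ENNReal.toReal_nonneg
      _ = (O.answer past a b (compare a b)).toReal * (G * (1 + 2 * δ)⁻¹) +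
            (1 - (O.answer past a b (compare a b)).toReal) * (G * (1 + 2 * δ)) := by
          have hrest := PMF.sum_toReal_eq_one (O.answer past a b)
          rw [← Finset.add_sum_erase _ _ (Finset.mem_univ (compare a b))] at hrest
          rw [← Finset.add_sum_erase _ _ (Finset.mem_univ (compare a b)), if_pos rfl,
            ← eq_sub_iff_add_eq'.2 hrest, Finset.sum_mul]
          congr 1
          exact Finset.sum_congr rfl fun o ho => by rw [if_neg (Finset.ne_of_mem_erase ho)]
      _ ≤ (1 - 2 * δ ^ 2) * G := key _ (O.le_answer_compare hδ hp past a b)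
      _ = _ := by rw [hG, pow_succ']; ring

theorem boosted_errs {δ : ℝ} (hδ₀ : 0 < δ) (hδ : δ < 1 / 2) (hp : p < 1 / 2 - δ) (r : ℕ)
    (a b : K) : (boosted r a b).Errs O ((1 - 2 * δ ^ 2) ^ r) (· = compare a b) := by
  refine (vote_errs hδ₀ hδ hp a b r 0 0 0).mono (le_of_eq ?_) fun _ => id
  cases compare a b <;> simp [wrongLead]

end Boosting

theorem vote_ensures {K : Type u} (a b : K) (r nlt neq ngt : ℕ) :
    (vote a b r nlt neq ngt).Ensures fun _ n => n = r + 1 := by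
  induction r generalizing nlt neq ngt with
  | zero => rfl
  | succ r ih =>
    intro o
    cases o <;> exact (ih _ _ _).mono fun _ n hn => by omega

theorem boosted_ensures {K : Type u} (r : ℕ) (a b : K) :
    (boosted r a b).Ensures fun _ n => n = r + 1 := vote_ensures a b r 0 0 0

/-! ### Positions of the walk and their distance from the target -/

section Positions

variable {K : Type u} {t : RBNode K} {s : Walker K}

/-- The subtree `s` with bounds `lo`, `hi` and the way up form a position in the tree `t`: going
up to the root restores `t`, and all bounds on the way are those given by the keys passed. -/
def Trail.Fits (t : RBNode K) : Trail K → RBNode K → Option K → Option K → Prop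
  | .root, s, lo, hi => s = t ∧ lo = none ∧ hi = none
  | .left c parent lo' hi' v r, s, lo, hi =>
      lo = lo' ∧ hi = some v ∧ parent.Fits t (node c s v r) lo' hi'
  | .right c l v lo' hi' parent, s, lo, hi =>
      lo = some v ∧ hi = hi' ∧ parent.Fits t (node c l v s) lo' hi'

namespace Walker

/-- The state of the walk is a position in `t`. -/
def Fits (t : RBNode K) (s : Walker K) : Prop := s.trail.Fits t s.focus s.lo s.hi

theorem fits_start (t : RBNode K) : (start t).Fits t := ⟨rfl, rfl, rfl⟩

theorem Fits.goUp (h : s.Fits t) : s.goUp.Fits t := by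
  obtain ⟨focus, lo, hi, trail, count⟩ := s
  cases trail with
  | root => exact h
  | left | right => exact h.2.2

theorem Fits.goLeft (h : s.Fits t) : s.goLeft.Fits t := by
  obtain ⟨_ | _, lo, hi, trail, count⟩ := s
  · exact h
  · exact ⟨rfl, rfl, h⟩

theorem Fits.goRight (h : s.Fits t) : s.goRight.Fits t := by
  obtain ⟨_ | _, lo, hi, trail, count⟩ := s
  · exact h
  · exact ⟨rfl, rfl, h⟩

@[simp] theorem count_goUp : s.goUp.count = s.count := by
  obtain ⟨focus, lo, hi, _ | _ | _, count⟩ := s <;> rfl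

@[simp] theorem count_goLeft : s.goLeft.count = s.count := by
  obtain ⟨_ | _, lo, hi, trail, count⟩ := s <;> rfl

@[simp] theorem count_goRight : s.goRight.count = s.count := by
  obtain ⟨_ | _, lo, hi, trail, count⟩ := s <;> rfl

end Walker

variable [LinearOrder K]

theorem cmpLT_compare_iff {a b : K} : cmpLT compare a b ↔ a < b :=
  cmpLT_iff.trans compare_lt_iff_lt

/-- `x` lies strictly between the bounds `lo` and `hi`, where `none` stands for `∓∞`. -/
def Between (lo hi : Option K) (x : K) : Prop := (∀ a ∈ lo, a < x) ∧ ∀ b ∈ hi, x < b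

theorem Trail.Fits.ordered_and_between {t : RBNode K} (ht : t.Ordered compare) {q : Trail K}
    {s : RBNode K} {lo hi : Option K} (h : q.Fits t s lo hi) :
    s.Ordered compare ∧ s.All (Between lo hi) := by
  induction q generalizing s lo hi with
  | root =>
    obtain ⟨rfl, rfl, rfl⟩ := h
    exact ⟨ht, .trivial ⟨by simp, by simp⟩⟩
  | left c parent lo' hi' v r ih =>
    obtain ⟨rfl, rfl, h⟩ := h
    obtain ⟨⟨sv, -, hs, -⟩, -, bs, -⟩ := ih h
    exact ⟨hs, (All_and.2 ⟨sv, bs⟩).imp fun h => ⟨h.2.1, by simpa using cmpLT_compare_iff.1 h.1⟩⟩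
  | right c l v lo' hi' parent ih =>
    obtain ⟨rfl, rfl, h⟩ := h
    obtain ⟨⟨-, vs, -, hs⟩, -, -, bs⟩ := ih h
    exact ⟨hs, (All_and.2 ⟨vs, bs⟩).imp fun h => ⟨by simpa using cmpLT_compare_iff.1 h.1, h.2.2⟩⟩

/-- The number of edges on the search path of `x` in a tree. -/
def searchDepth (x : K) : RBNode K → ℕ
  | nil => 0
  | node _ l v r =>
      if x < v then searchDepth x l + 1 else if v < x then searchDepth x r + 1 else 0

theorem searchDepth_le_depth (x : K) (t : RBNode K) : searchDepth x t ≤ t.depth := by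
  induction t with
  | nil => exact le_rfl
  | node c l v r ihl ihr =>
    simp only [searchDepth, depth]
    split_ifs <;> omega

open Classical in
/-- The distance in the walking tree from a position to the target of the search for `x`: if `x`
is between the bounds, the target is below, and otherwise the way to it leads over the parent. -/
noncomputable def Trail.dist (x : K) : Trail K → RBNode K → Option K → Option K → ℕ
  | .root, s, _, _ => searchDepth x s
  | .left c parent lo' hi' v r, s, lo, hi =>
      if Between lo hi x then searchDepth x s else parent.dist x (node c s v r) lo' hi' + 1
  | .right c l v lo' hi' parent, s, lo, hi =>
      if Between lo hi x then searchDepth x s else parent.dist x (node c l v s) lo' hi' + 1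

theorem Trail.dist_of_between {x : K} (q : Trail K) (s : RBNode K) {lo hi : Option K}
    (h : Between lo hi x) : q.dist x s lo hi = searchDepth x s := by
  cases q <;> simp [Trail.dist, h]

namespace Walker

/-- The distance from the current node to the target of the search for `x`. -/
noncomputable def dist (x : K) (s : Walker K) : ℕ := s.trail.dist x s.focus s.lo s.hi

variable {x : K}

theorem dist_of_between (h : Between s.lo s.hi x) : s.dist x = searchDepth x s.focus :=
  s.trail.dist_of_between _ h

theorem dist_start (t : RBNode K) (x : K) : (start t).dist x = searchDepth x t := rfl

theorem dist_goUp_of_not_between (hs : s.Fits t) (h : ¬ Between s.lo s.hi x) :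
    s.goUp.dist x + 1 = s.dist x := by
  obtain ⟨focus, lo, hi, trail, count⟩ := s
  cases trail with
  | root =>
    obtain ⟨-, rfl, rfl⟩ := hs
    exact absurd ⟨by simp, by simp⟩ h
  | left | right => simp_all [Walker.goUp, Walker.dist, Trail.dist]

theorem dist_goUp_le (ht : t.Ordered compare) (hs : s.Fits t) :
    s.goUp.dist x ≤ s.dist x + 1 := by
  by_cases h : Between s.lo s.hi x
  · rw [dist_of_between h]
    obtain ⟨focus, lo, hi, trail, count⟩ := s
    cases trail with
    | root => exact Nat.le_succ _
    | left c parent lo' hi' v r =>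
      simp only [Fits, Trail.Fits] at hs
      obtain ⟨rfl, rfl, hs⟩ := hs
      have hv : x < v := by simpa using h.2
      have hb : Between lo hi' x :=
        ⟨h.1, fun b hb => hv.trans ((hs.ordered_and_between ht).2.1.2 b hb)⟩
      simp only [Walker.goUp, Walker.dist]
      rw [Trail.dist_of_between _ _ hb]
      simp [searchDepth, hv]
    | right c l v lo' hi' parent =>
      simp only [Fits, Trail.Fits] at hs
      obtain ⟨rfl, rfl, hs⟩ := hs
      have hv : v < x := by simpa using h.1
      have hb : Between lo' hi x :=
        ⟨fun b hb => ((hs.ordered_and_between ht).2.1.1 b hb).trans hv, h.2⟩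
      simp only [Walker.goUp, Walker.dist]
      rw [Trail.dist_of_between _ _ hb]
      simp [searchDepth, hv, hv.not_gt]
  · have := dist_goUp_of_not_between hs h
    omega

theorem dist_goLeft_le (ht : t.Ordered compare) (hs : s.Fits t) :
    s.goLeft.dist x ≤ s.dist x + 1 := by
  by_cases h : Between s.goLeft.lo s.goLeft.hi x
  · by_cases h' : Between s.lo s.hi x
    · rw [dist_of_between h, dist_of_between h']
      obtain ⟨_ | ⟨c, l, v, r⟩, lo, hi, trail, count⟩ := s
      · exact Nat.le_succ _
      · have hv : x < v := h.2 v rfl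
        simp only [Walker.goLeft, searchDepth, hv, if_true]
        omega
    · obtain ⟨_ | ⟨c, l, v, r⟩, lo, hi, trail, count⟩ := s
      · exact absurd h h'
      · have hv : x < v := h.2 v rfl
        exact absurd ⟨h.1, fun b hb =>
          hv.trans ((Trail.Fits.ordered_and_between ht hs).2.1.2 b hb)⟩ h'
  · obtain ⟨_ | ⟨c, l, v, r⟩, lo, hi, trail, count⟩ := s
    · exact Nat.le_succ _
    · exact (dist_goUp_of_not_between hs.goLeft h).ge

theorem dist_goRight_le (ht : t.Ordered compare) (hs : s.Fits t) :
    s.goRight.dist x ≤ s.dist x + 1 := by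
  by_cases h : Between s.goRight.lo s.goRight.hi x
  · by_cases h' : Between s.lo s.hi x
    · rw [dist_of_between h, dist_of_between h']
      obtain ⟨_ | ⟨c, l, v, r⟩, lo, hi, trail, count⟩ := s
      · exact Nat.le_succ _
      · have hv : v < x := h.1 v rfl
        simp only [Walker.goRight, searchDepth, hv, hv.not_gt, if_true, if_false]
        omega
    · obtain ⟨_ | ⟨c, l, v, r⟩, lo, hi, trail, count⟩ := s
      · exact absurd h h'
      · have hv : v < x := h.1 v rfl
        exact absurd ⟨fun b hb =>
          ((Trail.Fits.ordered_and_between ht hs).2.1.1 b hb).trans hv, h.2⟩ h'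
  · obtain ⟨_ | ⟨c, l, v, r⟩, lo, hi, trail, count⟩ := s
    · exact Nat.le_succ _
    · exact (dist_goUp_of_not_between hs.goRight h).ge

theorem dist_goLeft_of_lt {c : RBColor} {l r : RBNode K} {v : K}
    (hf : s.focus = node c l v r) (h : Between s.lo s.hi x) (hv : x < v) :
    s.goLeft.dist x + 1 = s.dist x := by
  obtain ⟨focus, lo, hi, trail, count⟩ := s
  obtain rfl := hf
  rw [dist_of_between h, dist_of_between (s := goLeft _) ⟨h.1, by simpa [Walker.goLeft] using hv⟩]
  simp [Walker.goLeft, searchDepth, hv]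

theorem dist_goRight_of_lt {c : RBColor} {l r : RBNode K} {v : K}
    (hf : s.focus = node c l v r) (h : Between s.lo s.hi x) (hv : v < x) :
    s.goRight.dist x + 1 = s.dist x := by
  obtain ⟨focus, lo, hi, trail, count⟩ := s
  obtain rfl := hf
  rw [dist_of_between h, dist_of_between (s := goRight _) ⟨by simpa [Walker.goRight] using hv, h.2⟩]
  simp [Walker.goRight, searchDepth, hv, hv.not_gt]

theorem between_of_dist_eq_zero (hs : s.Fits t) (h : s.dist x = 0) : Between s.lo s.hi x := by
  by_contra h'
  have := dist_goUp_of_not_between hs h'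
  omega

theorem dist_eq_zero_iff_of_nil (hs : s.Fits t) (hf : s.focus = nil) :
    s.dist x = 0 ↔ Between s.lo s.hi x :=
  ⟨between_of_dist_eq_zero hs, fun h => by rw [dist_of_between h, hf, searchDepth]⟩

theorem dist_eq_zero_iff_of_node (ht : t.Ordered compare) (hs : s.Fits t)
    {c : RBColor} {l r : RBNode K} {v : K} (hf : s.focus = node c l v r) :
    s.dist x = 0 ↔ v = x := by
  constructor
  · intro h
    rw [dist_of_between (between_of_dist_eq_zero hs h), hf, searchDepth] at h
    split_ifs at h with h₁ h₂
    exact le_antisymm (not_lt.1 h₁) (not_lt.1 h₂)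
  · rintro rfl
    have hb := (Trail.Fits.ordered_and_between ht hs).2
    rw [hf] at hb
    rw [dist_of_between hb.1, hf, searchDepth]
    simp

/-- The potential of a state.  Away from the target it is the number of error-free steps that lead
to the target: the counter has to go down to zero before the walk moves on.  At the target it is
minus the counter, the number of wrong steps that the walk can bear before it leaves.  It is
positive if and only if the current node is not the target. -/
noncomputable def potential (x : K) (s : Walker K) : ℤ :=
  if s.dist x = 0 then -s.count else s.dist x + s.count

theorem dist_eq_zero_of_potential_nonpos (h : s.potential x ≤ 0) : s.dist x = 0 := by
  unfold potential at h
  split_ifs at h with h'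
  · exact h'
  · omega

theorem potential_of_count_eq_zero (h : s.count = 0) : s.potential x = s.dist x := by
  unfold potential; split_ifs <;> simp_all

end Walker

end Positions

/-! ### One step of the walk -/

section Tests

variable {K : Type u}

theorem isAbove_ensures (r : ℕ) (a : Option K) (b : K) :
    (isAbove r a b).Ensures fun _ n => n ≤ r + 1 := by
  cases a with
  | none => exact Nat.zero_le _
  | some a => exact (boosted_ensures r a b).bind fun o n hn => hn.le

theorem isBelow_ensures (r : ℕ) (a : K) (b : Option K) :
    (isBelow r a b).Ensures fun _ n => n ≤ r + 1 := by
  cases b with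
  | none => exact Nat.zero_le _
  | some b => exact (boosted_ensures r a b).bind fun o n hn => hn.le

theorem isNodeCorrect_ensures (r : ℕ) (x : K) (s : Walker K) :
    (isNodeCorrect r x s).Ensures fun _ n => n ≤ 2 * r + 2 :=
  (isAbove_ensures r s.lo x).bind fun _ n hn =>
    (isBelow_ensures r x s.hi).bind fun _ m hm => by simp only [Prog.Ensures]; omega

theorem isTheTarget_ensures (r : ℕ) (x : K) (s : Walker K) :
    (isTheTarget r x s).Ensures fun _ n => n ≤ 2 * r + 2 := by
  unfold isTheTarget
  split
  · exact isNodeCorrect_ensures r x s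
  · exact (boosted_ensures r _ x).bind fun o n hn => by simp only [Prog.Ensures]; omega

theorem selectChild_ensures (r : ℕ) (x : K) (s : Walker K) :
    (selectChild r x s).Ensures fun s' n =>
      (s' = s ∨ s' = s.goLeft ∨ s' = s.goRight) ∧ n ≤ r + 1 := by
  unfold selectChild
  split
  · exact ⟨.inl rfl, Nat.zero_le _⟩
  · refine (boosted_ensures r _ x).bind fun o n hn => ?_
    split
    · exact ⟨.inr (.inr rfl), hn.le⟩
    · exact ⟨.inr (.inl rfl), hn.le⟩

variable [LinearOrder K] {p : ℝ} {O : NoisyCompare K p} {r : ℕ} {η : ℝ} {x : K}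

theorem isAbove_errs (hη : 0 ≤ η) (h : ∀ a b, (boosted r a b).Errs O η (· = compare a b))
    (a : Option K) (b : K) : (isAbove r a b).Errs O η fun β => β = true ↔ ∀ y ∈ a, y < b := by
  cases a with
  | none =>
    exact (Prog.Ensures.errs (by simp [isAbove, Prog.Ensures])).mono hη fun _ => id
  | some a =>
    refine ((h a b).bind le_rfl fun o ho => Prog.Ensures.errs ?_).mono (add_zero η).le fun _ => id
    simp [Prog.Ensures, ho, compare_lt_iff_lt]

theorem isBelow_errs (hη : 0 ≤ η) (h : ∀ a b, (boosted r a b).Errs O η (· = compare a b))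
    (a : K) (b : Option K) : (isBelow r a b).Errs O η fun β => β = true ↔ ∀ y ∈ b, a < y := by
  cases b with
  | none =>
    exact (Prog.Ensures.errs (by simp [isBelow, Prog.Ensures])).mono hη fun _ => id
  | some b =>
    refine ((h a b).bind le_rfl fun o ho => Prog.Ensures.errs ?_).mono (add_zero η).le fun _ => id
    simp [Prog.Ensures, ho, compare_lt_iff_lt]

theorem isNodeCorrect_errs (hη : 0 ≤ η) (h : ∀ a b, (boosted r a b).Errs O η (· = compare a b))
    (s : Walker K) :
    (isNodeCorrect r x s).Errs O (2 * η) fun β => β = true ↔ Between s.lo s.hi x := by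
  refine ((isAbove_errs hη h s.lo x).bind (add_nonneg hη le_rfl) fun b₁ h₁ =>
    (isBelow_errs hη h x s.hi).bind le_rfl fun b₂ h₂ => Prog.Ensures.errs ?_).mono
      (by linarith) fun _ => id
  simp [Prog.Ensures, h₁, h₂, Between]

theorem isTheTarget_errs {t : RBNode K} (ht : t.Ordered compare) (hη : 0 ≤ η)
    (h : ∀ a b, (boosted r a b).Errs O η (· = compare a b)) {s : Walker K} (hs : s.Fits t) :
    (isTheTarget r x s).Errs O (2 * η) fun β => β = true ↔ s.dist x = 0 := by
  unfold isTheTarget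
  split
  · next hf =>
    exact (isNodeCorrect_errs hη h s).mono le_rfl fun β hβ =>
      hβ.trans (Walker.dist_eq_zero_iff_of_nil hs hf).symm
  · next c l v r' hf =>
    refine ((h v x).bind le_rfl fun o ho => Prog.Ensures.errs ?_).mono
      (by linarith : η + 0 ≤ 2 * η) fun _ => id
    simp [Prog.Ensures, ho, Walker.dist_eq_zero_iff_of_node ht hs hf]

theorem selectChild_errs {t : RBNode K} (ht : t.Ordered compare)
    (h : ∀ a b, (boosted r a b).Errs O η (· = compare a b)) {s : Walker K} (hs : s.Fits t)
    (hb : Between s.lo s.hi x) (hd : s.dist x ≠ 0) :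
    (selectChild r x s).Errs O η fun s' => s'.dist x + 1 = s.dist x ∧ s'.count = s.count := by
  unfold selectChild
  split
  · next hf => exact absurd ((Walker.dist_eq_zero_iff_of_nil hs hf).2 hb) hd
  · next c l v r' hf =>
    refine ((h v x).bind le_rfl fun o ho => Prog.Ensures.errs ?_).mono (add_zero η).le fun _ => id
    rw [Ne, Walker.dist_eq_zero_iff_of_node ht hs hf] at hd
    subst ho
    split_ifs with hlt
    · exact ⟨Walker.dist_goRight_of_lt hf hb (compare_lt_iff_lt.1 hlt), Walker.count_goRight⟩
    · refine ⟨Walker.dist_goLeft_of_lt hf hb ?_, Walker.count_goLeft⟩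
      exact lt_of_le_of_ne (not_lt.1 fun h' => hlt (compare_lt_iff_lt.2 h')) (Ne.symm hd)

end Tests

section Step

variable {K : Type u} [LinearOrder K] {t : RBNode K} {x : K}

namespace Walker

theorem potential_le_of_dist_le {s s' : Walker K} (hc : s.count = 0) (hc' : s'.count = s.count)
    (h : s'.dist x ≤ s.dist x + 1) : s'.potential x ≤ s.potential x + 1 := by
  rw [potential_of_count_eq_zero hc, potential_of_count_eq_zero (hc'.trans hc)]
  exact_mod_cast h

theorem potential_le_of_dist_add_one_eq {s s' : Walker K} (hc : s.count = 0)
    (hc' : s'.count = s.count) (h : s'.dist x + 1 = s.dist x) :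
    s'.potential x ≤ s.potential x - 1 := by
  rw [potential_of_count_eq_zero hc, potential_of_count_eq_zero (hc'.trans hc), ← h]
  push_cast
  linarith

theorem potential_count_le (s : Walker K) {k : ℕ} (h₁ : s.count ≤ k + 1) (h₂ : k ≤ s.count + 1) :
    ({ s with count := k } : Walker K).potential x ≤ s.potential x + 1 := by
  have hd : ({ s with count := k } : Walker K).dist x = s.dist x := rfl
  unfold potential
  rw [hd]
  split_ifs <;> simp <;> omega

end Walker

/-- A step of the walk leads to another position of the same tree, and even if there are errors,
the potential grows by at most one. -/
theorem oneStep_ensures (ht : t.Ordered compare) (r : ℕ) {s : Walker K} (hs : s.Fits t) :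
    (oneStep r x s).Ensures fun s' n =>
      (s'.Fits t ∧ s'.potential x ≤ s.potential x + 1) ∧ n ≤ 5 * r + 6 := by
  simp only [oneStep, Prog.Ensures]
  split_ifs with hc
  · refine (isNodeCorrect_ensures r x s).bind fun b n hn => ?_
    split_ifs
    · refine (isTheTarget_ensures r x s).bind fun b' n' hn' => ?_
      split_ifs
      · exact ⟨⟨hs, s.potential_count_le (by omega) (by omega)⟩, by omega⟩
      · refine (selectChild_ensures r x s).mono fun s' m hm => ⟨?_, by omega⟩
        obtain ⟨rfl | rfl | rfl, -⟩ := hm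
        · exact ⟨hs, by omega⟩
        · exact ⟨hs.goLeft, Walker.potential_le_of_dist_le hc (by simp)
            (Walker.dist_goLeft_le ht hs)⟩
        · exact ⟨hs.goRight, Walker.potential_le_of_dist_le hc (by simp)
            (Walker.dist_goRight_le ht hs)⟩
    · exact ⟨⟨hs.goUp, Walker.potential_le_of_dist_le hc (by simp) (Walker.dist_goUp_le ht hs)⟩,
        by omega⟩
  · refine (isTheTarget_ensures r x s).bind fun b n hn => ?_
    split_ifs
    · exact ⟨⟨hs, s.potential_count_le (by omega) (by omega)⟩, by omega⟩
    · exact ⟨⟨hs, s.potential_count_le (by omega) (by omega)⟩, by omega⟩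

variable {p : ℝ} {O : NoisyCompare K p} {r : ℕ} {η : ℝ}

/-- A step of the walk without errors decreases the potential. -/
theorem oneStep_errs (ht : t.Ordered compare) (hη : 0 ≤ η)
    (h : ∀ a b, (boosted r a b).Errs O η (· = compare a b)) {s : Walker K} (hs : s.Fits t) :
    (oneStep r x s).Errs O (5 * η) fun s' => s'.potential x ≤ s.potential x - 1 := by
  intro past
  change Prog.failure O (if s.count = 0 then _ else _) past _ ≤ _
  revert past
  change Prog.Errs O _ _ _
  split_ifs with hc
  · refine ((isNodeCorrect_errs (x := x) hη h s).bind (η₂ := 3 * η) (by linarith)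
      fun b hb => ?_).mono (by linarith : 2 * η + 3 * η ≤ 5 * η) fun _ => id
    split_ifs with hb'
    · refine ((isTheTarget_errs (x := x) ht hη h hs).bind hη fun b' hd => ?_).mono
        (by linarith : 2 * η + η ≤ 3 * η) fun _ => id
      split_ifs with hd'
      · refine (Prog.Ensures.errs ?_).mono hη fun _ => id
        have hd₁ : s.dist x = 0 := hd.1 hd'
        have hd₂ : ({ s with count := 1 } : Walker K).dist x = 0 := hd₁
        simp [Prog.Ensures, Walker.potential, hd₁, hd₂, hc]
      · exact (selectChild_errs ht h hs (hb.1 hb') fun h0 => hd' (hd.2 h0)).mono le_rfl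
          fun s' hs' => Walker.potential_le_of_dist_add_one_eq hc hs'.2 hs'.1
    · refine (Prog.Ensures.errs ?_).mono (by linarith : 0 ≤ 3 * η) fun _ => id
      exact Walker.potential_le_of_dist_add_one_eq hc (by simp)
        (Walker.dist_goUp_of_not_between hs fun hb'' => hb' (hb.2 hb''))
  · refine ((isTheTarget_errs (x := x) ht hη h hs).bind (η₂ := 0) le_rfl fun b hd => ?_).mono
      (by linarith : 2 * η + 0 ≤ 5 * η) fun _ => id
    split_ifs with hd'
    · refine Prog.Ensures.errs ?_
      have hd₁ : s.dist x = 0 := hd.1 hd'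
      have hd₂ : ({ s with count := s.count + 1 } : Walker K).dist x = 0 := hd₁
      simp [Prog.Ensures, Walker.potential, hd₁, hd₂]
    · refine Prog.Ensures.errs ?_
      have hd₁ : s.dist x ≠ 0 := fun h0 => hd' (hd.2 h0)
      have hd₂ : ({ s with count := s.count - 1 } : Walker K).dist x = s.dist x := rfl
      simp only [Prog.Ensures, Walker.potential, hd₂, if_neg hd₁]
      omega

/-! ### The whole walk -/

theorem steps_ensures (ht : t.Ordered compare) (r : ℕ) (m : ℕ) {s : Walker K} (hs : s.Fits t) :
    (steps r x m s).Ensures fun s' n => s'.Fits t ∧ n ≤ m * (5 * r + 6) := by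
  induction m generalizing s with
  | zero => exact ⟨hs, Nat.zero_le _⟩
  | succ m ih =>
    refine (oneStep_ensures ht r hs).bind fun s' n hs' => (ih hs'.1.1).mono fun s'' n' h => ⟨h.1, ?_⟩
    rw [Nat.succ_mul]
    omega

/-- The mean of `4 ^ potential` is at least halved by each step if a step goes wrong with
probability at most `1 / 16`, since `1 / 4 + 4 / 16 = 1 / 2`; as there are at most five votes in a
step, `η ≤ 1 / 80` is enough for this.  At the end, `4 ^ potential` is at
least one unless the walk has reached the target. -/
theorem steps_errs (ht : t.Ordered compare) (hη : 0 ≤ η) (hη' : η ≤ 1 / 80)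
    (h : ∀ a b, (boosted r a b).Errs O η (· = compare a b)) (m : ℕ) {s : Walker K}
    (hs : s.Fits t) :
    (steps r x m s).Errs O ((1 / 2) ^ m * 4 ^ s.potential x) fun s' => s'.dist x = 0 := by
  induction m generalizing s with
  | zero =>
    intro past
    simp only [steps, Prog.failure, Prog.expect, pow_zero, one_mul]
    split_ifs with hd
    · positivity
    · refine one_le_zpow₀ (by norm_num) ?_
      by_contra! hlt
      exact hd (Walker.dist_eq_zero_of_potential_nonpos hlt.le)
  | succ m ih =>
    intro past
    set A : ℝ := (1 / 2) ^ m * 4 ^ s.potential x with hA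
    have hA₀ : 0 ≤ A := by positivity
    have up : (4 : ℝ) ^ (s.potential x + 1) = 4 ^ s.potential x * 4 :=
      zpow_add_one₀ (by norm_num) _
    have down : (4 : ℝ) ^ (s.potential x - 1) = 4 ^ s.potential x * 4⁻¹ :=
      zpow_sub_one₀ (by norm_num) _
    have key : (steps r x (m + 1) s).failure O past (fun s' => s'.dist x = 0) ≤
        A / 4 + 4 * A * (oneStep r x s).failure O past
          fun s' => s'.potential x ≤ s.potential x - 1 := by
      refine Prog.failure_bind_le ((oneStep_ensures ht r hs).mono fun s' n hs' => ⟨?_, ?_⟩) past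
      · refine fun hgood => (ih hs'.1.1).mono ?_ fun _ => id
        have : (1 / 2 : ℝ) ^ m * 4 ^ s'.potential x ≤
            (1 / 2) ^ m * 4 ^ (s.potential x - 1) := by
          gcongr
          norm_num
        rw [down, ← mul_assoc, ← hA] at this
        linarith
      · refine fun _ => (ih hs'.1.1).mono ?_ fun _ => id
        have : (1 / 2 : ℝ) ^ m * 4 ^ s'.potential x ≤
            (1 / 2) ^ m * 4 ^ (s.potential x + 1) := by
          gcongr
          · norm_num
          · exact hs'.1.2
        rw [up, ← mul_assoc, ← hA] at this
        linarith
    have := mul_le_mul_of_nonneg_left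
      ((oneStep_errs (x := x) ht hη h hs past).trans (by linarith : 5 * η ≤ 1 / 16))
      (by linarith : 0 ≤ 4 * A)
    calc (steps r x (m + 1) s).failure O past (fun s' => s'.dist x = 0) ≤ A / 2 := by linarith
      _ = _ := by rw [hA, pow_succ']; ring

/-- The depth of the leftmost `nil` leaf. -/
def leftHeight {K : Type u} : RBNode K → ℕ
  | nil => 0
  | node _ l _ _ => leftHeight l + 1

theorem leftDepth_ensures {K : Type u} (t : RBNode K) (d : ℕ) :
    (leftDepth t d).Ensures fun d' n => d' = leftHeight t + d ∧ n = leftHeight t + 1 := by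
  induction t generalizing d with
  | nil => exact ⟨(Nat.zero_add d).symm, rfl⟩
  | node c l v r ihl ihr =>
    exact (ihl (d + 1)).mono fun d' n h => ⟨by rw [h.1, leftHeight]; omega, by rw [h.2, leftHeight]⟩

theorem leftHeight_le_depth {K : Type u} (t : RBNode K) : leftHeight t ≤ t.depth := by
  induction t with
  | nil => exact le_rfl
  | node c l v r ihl ihr => simp only [leftHeight, depth]; omega

theorem le_leftHeight_of_balanced {K : Type u} {t : RBNode K} {c : RBColor} {n : ℕ}
    (h : t.Balanced c n) : n ≤ leftHeight t := by
  induction h with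
  | nil => exact le_rfl
  | red _ _ ih _ => exact ih.trans (Nat.le_succ _)
  | black _ _ ih _ => exact Nat.succ_le_succ ih

theorem depth_le_two_mul_leftHeight {K : Type u} {t : RBNode K} {n : ℕ}
    (h : t.Balanced black n) : t.depth ≤ 2 * leftHeight t :=
  h.depth_le.trans (Nat.mul_le_mul_left 2 (le_leftHeight_of_balanced h))

/-- The path of `Batteries` that underlies the way up to the root. -/
def Trail.path {K : Type u} : Trail K → RBNode.Path K
  | .root => .root
  | .left c parent _ _ v r => .left c parent.path v r
  | .right c l v _ _ parent => .right c l v parent.path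

/-- The number of edges of a path. -/
def pathLength {K : Type u} : RBNode.Path K → ℕ
  | .root => 0
  | .left _ parent _ _ => pathLength parent + 1
  | .right _ _ _ parent => pathLength parent + 1

theorem depth_add_pathLength_le {K : Type u} (path : RBNode.Path K) (s : RBNode K) :
    s.depth + pathLength path ≤ (path.fill s).depth := by
  induction path generalizing s with
  | root => exact le_rfl
  | left c parent v r ih =>
    refine le_trans ?_ (ih _)
    simp only [pathLength, depth]; omega
  | right c l v parent ih =>
    refine le_trans ?_ (ih _)
    simp only [pathLength, depth]; omega

theorem toPath_ensures {K : Type u} (q : Trail K) :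
    q.toPath.Ensures fun path n => path = q.path ∧ n = pathLength q.path + 1 := by
  induction q with
  | root => exact ⟨rfl, rfl⟩
  | left c parent lo hi v r ih =>
    exact ih.bind fun path n h => ⟨by rw [h.1, Trail.path], by rw [h.2, Trail.path, pathLength]⟩
  | right c l v lo hi parent ih =>
    exact ih.bind fun path n h => ⟨by rw [h.1, Trail.path], by rw [h.2, Trail.path, pathLength]⟩

theorem Trail.Fits.fill_path {K : Type u} {t : RBNode K} {q : Trail K} {s : RBNode K}
    {lo hi : Option K} (h : q.Fits t s lo hi) : q.path.fill s = t := by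
  induction q generalizing s lo hi with
  | root => exact h.1
  | left c parent lo' hi' v r ih => exact ih h.2.2
  | right c l v lo' hi' parent ih => exact ih h.2.2

theorem walk_ensures (ht : t.Ordered compare) (r c L : ℕ) :
    (walk r c L t x).Ensures fun z n => z.2.fill z.1 = t ∧
      n ≤ c * (2 * leftHeight t + L) * (5 * r + 6) + 2 * t.depth + 2 := by
  refine (leftDepth_ensures t 0).bind fun d n hd => ?_
  obtain ⟨rfl, rfl⟩ := hd
  refine (steps_ensures ht r _ (Walker.fits_start t)).bind fun s m hs => ?_
  refine (toPath_ensures s.trail).bind fun path k hk => ?_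
  obtain ⟨rfl, rfl⟩ := hk
  have hfill : s.trail.path.fill s.focus = t := hs.1.fill_path
  have h₁ := depth_add_pathLength_le s.trail.path s.focus
  rw [hfill] at h₁
  have h₂ := leftHeight_le_depth t
  refine ⟨hfill, ?_⟩
  have h₃ := hs.2
  rw [Nat.add_zero] at h₃
  omega

/-- The walk stops at the target, the node or leaf where the search path of `x` ends. -/
def ReachesTarget (t : RBNode K) (x : K) (z : RBNode K × RBNode.Path K) : Prop :=
  ∃ s : Walker K, s.Fits t ∧ s.dist x = 0 ∧ z = (s.focus, s.trail.path)

/-- The potential at the start is at most the depth of the tree, hence at most `2 * d`, and so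
`2 * (2 * d + L)` steps bring the mean of `4 ^ potential` down to `4⁻¹ ^ L`. -/
theorem walk_errs {n : ℕ} (ht : t.Ordered compare) (hbal : t.Balanced black n) (hη : 0 ≤ η)
    (hη' : η ≤ 1 / 80) (h : ∀ a b, (boosted r a b).Errs O η (· = compare a b)) (L : ℕ) :
    (walk r 2 L t x).Errs O ((1 / 4) ^ L) (ReachesTarget t x) := by
  have hsteps : ((steps r x (2 * (2 * (leftHeight t + 0) + L)) (Walker.start t)).bind fun s =>
      s.trail.toPath.bind fun path => .ret (s.focus, path)).Errs O ((1 / 4) ^ L)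
        (ReachesTarget t x) := by
    set m := 2 * (2 * (leftHeight t + 0) + L) with hm
    have hfit : (steps r x m (Walker.start t)).Errs O ((1 / 4) ^ L)
        fun s => s.Fits t ∧ s.dist x = 0 := by
      have hpot : (1 / 2 : ℝ) ^ m * 4 ^ (Walker.start t).potential x ≤ (1 / 4) ^ L := by
        rw [Walker.potential_of_count_eq_zero rfl, Walker.dist_start, zpow_natCast]
        have hle : searchDepth x t ≤ 2 * leftHeight t :=
          (searchDepth_le_depth x t).trans (depth_le_two_mul_leftHeight hbal)
        have hpow : (4 : ℝ) ^ searchDepth x t ≤ 4 ^ (2 * leftHeight t) :=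
          pow_le_pow_right₀ (by norm_num) hle
        calc (1 / 2 : ℝ) ^ m * 4 ^ searchDepth x t
            ≤ (1 / 2 : ℝ) ^ m * 4 ^ (2 * leftHeight t) := by gcongr
          _ = (1 / 4) ^ L := by
            rw [hm, pow_mul, add_zero, pow_add, mul_right_comm, ← mul_pow]
            norm_num
      exact ((steps_errs (x := x) ht hη hη' h m (Walker.fits_start t)).mono hpot
        fun _ => id).and_of_ensures
          ((steps_ensures ht r m (Walker.fits_start t)).mono fun s n hs => hs.1)
    refine (hfit.bind le_rfl fun s hs => Prog.Ensures.errs ?_).mono (add_zero _).le fun _ => id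
    refine (toPath_ensures s.trail).bind fun path k hk => ?_
    exact ⟨s, hs.1, hs.2, by rw [hk.1]⟩
  intro past
  rw [← (leftDepth t 0).expect_const (O := O) ((1 / 4 : ℝ) ^ L) past]
  refine Prog.expect_bind_le ((leftDepth_ensures t 0).mono fun d k hd => ?_) past
  rw [hd.1]
  exact hsteps

end Step

/-! ### The tree surgery -/

section Surgery

variable {K : Type u}

theorem fill_ensures (path : RBNode.Path K) (s : RBNode K) :
    (fill path s).Ensures fun t n => t = path.fill s ∧ n = pathLength path + 1 := by
  induction path generalizing s with
  | root => exact ⟨rfl, rfl⟩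
  | left c parent v r ih => exact (ih _).mono fun t n h => ⟨h.1, by rw [h.2, pathLength]⟩
  | right c l v parent ih => exact (ih _).mono fun t n h => ⟨h.1, by rw [h.2, pathLength]⟩

theorem rebalanceInsert_ensures (path : RBNode.Path K) (s : RBNode K) :
    (rebalanceInsert path s).Ensures fun t n => t = path.ins s ∧ n = pathLength path + 1 := by
  induction path generalizing s with
  | root => exact ⟨rfl, rfl⟩
  | left c parent v r ih =>
    cases c <;> exact (ih _).mono fun t n h => ⟨h.1, by rw [h.2, pathLength]⟩
  | right c l v parent ih =>
    cases c <;> exact (ih _).mono fun t n h => ⟨h.1, by rw [h.2, pathLength]⟩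

theorem rebalanceDelete_ensures (path : RBNode.Path K) (s : RBNode K) (col : RBColor) :
    (rebalanceDelete path s col).Ensures fun t n =>
      t = path.del s col ∧ n = pathLength path + 1 := by
  induction path generalizing s col with
  | root => exact ⟨rfl, rfl⟩
  | left c parent v r ih =>
    cases col <;> exact (ih _ _).mono fun t n h => ⟨h.1, by rw [h.2, pathLength]⟩
  | right c l v parent ih =>
    cases col <;> exact (ih _ _).mono fun t n h => ⟨h.1, by rw [h.2, pathLength]⟩

theorem join_ensures (a b : RBNode K) :
    (join a b).Ensures fun t n => t = a.append b ∧ n ≤ a.depth + b.depth + 1 := by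
  induction a, b using join.induct with
  | case1 t => rw [join, append]; exact ⟨rfl, Nat.le_add_left _ _⟩
  | case2 t h =>
    rw [join, append]
    · exact ⟨rfl, Nat.le_add_left _ _⟩
    all_goals exact h
  | case3 a x b c y d ih =>
    rw [join, append]
    refine ih.bind fun m n hm => ?_
    obtain ⟨rfl, hn⟩ := hm
    generalize b.append c = m
    obtain _ | ⟨_ | _, _, _, _⟩ := m <;> refine ⟨rfl, ?_⟩ <;> simp only [depth] <;> omega
  | case4 a x b c y d ih =>
    rw [join, append]
    refine ih.bind fun m n hm => ?_
    obtain ⟨rfl, hn⟩ := hm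
    generalize b.append c = m
    obtain _ | ⟨_ | _, _, _, _⟩ := m <;> refine ⟨rfl, ?_⟩ <;> simp only [depth] <;> omega
  | case5 a x b c y d ih =>
    rw [join, append]
    refine ih.bind fun m n hm => ?_
    obtain ⟨rfl, hn⟩ := hm
    refine ⟨rfl, ?_⟩; simp only [depth] at hn ⊢; omega
  | case6 a x b c y d ih =>
    rw [join, append]
    refine ih.bind fun m n hm => ?_
    obtain ⟨rfl, hn⟩ := hm
    refine ⟨rfl, ?_⟩; simp only [depth] at hn ⊢; omega

theorem append_toList (a b : RBNode K) : (a.append b).toList = a.toList ++ b.toList := by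
  fun_induction append a b <;> simp_all
  all_goals next ih => rw [← List.append_assoc _ _ (_ :: _), ← ih]; simp

theorem del_toList (path : RBNode.Path K) (s : RBNode K) (col : RBColor) :
    (path.del s col).toList = path.withList s.toList := by
  induction path generalizing s col with
  | root => simp [Path.del]
  | left c parent v r ih => cases col <;> simp [Path.del, ih]
  | right c l v parent ih => cases col <;> simp [Path.del, ih]

/-- If filling the hole of a path gives a balanced tree, then both the path and the filling are
balanced. -/
theorem balanced_of_balanced_fill {path : RBNode.Path K} {s : RBNode K} {c₀ : RBColor} {n₀ : ℕ}
    (h : (path.fill s).Balanced c₀ n₀) :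
    ∃ c n, path.Balanced c₀ n₀ c n ∧ s.Balanced c n := by
  induction path generalizing s with
  | root => exact ⟨_, _, .root, h⟩
  | left c parent v r ih =>
    obtain ⟨c', n', hp, hs⟩ := ih h
    cases hs with
    | red hl hr => exact ⟨_, _, .redL hr hp, hl⟩
    | black hl hr => exact ⟨_, _, .blackL hr hp, hl⟩
  | right c l v parent ih =>
    obtain ⟨c', n', hp, hs⟩ := ih h
    cases hs with
    | red hl hr => exact ⟨_, _, .redR hl hp, hr⟩
    | black hl hr => exact ⟨_, _, .blackR hl hp, hr⟩

end Surgery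

/-! ### Correctness of the operations -/

section Correctness

variable {K : Type u} [LinearOrder K] {t : RBNode K} {x : K}

theorem Trail.Fits.rootOrdered {q : Trail K} {s : RBNode K} {lo hi : Option K}
    (ht : t.Ordered compare) (h : q.Fits t s lo hi) (hx : Between lo hi x) :
    q.path.RootOrdered compare x := by
  induction q generalizing s lo hi with
  | root => trivial
  | left c parent lo' hi' v r ih =>
    obtain ⟨rfl, rfl, h⟩ := h
    have hv : x < v := hx.2 v rfl
    exact ⟨cmpLT_compare_iff.2 hv, ih h ⟨hx.1, fun b hb =>
      hv.trans ((h.ordered_and_between ht).2.1.2 b hb)⟩⟩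
  | right c l v lo' hi' parent ih =>
    obtain ⟨rfl, rfl, h⟩ := h
    have hv : v < x := hx.1 v rfl
    exact ⟨cmpLT_compare_iff.2 hv, ih h ⟨fun b hb =>
      ((h.ordered_and_between ht).2.1.1 b hb).trans hv, hx.2⟩⟩

theorem isSearchResult_of_reachesTarget (ht : IsRedBlack t) {z : RBNode K × RBNode.Path K}
    (hz : ReachesTarget t x z) : IsSearchResult t x z := by
  obtain ⟨s, hs, hd, rfl⟩ := hz
  have hfill : s.trail.path.fill s.focus = t := Trail.Fits.fill_path hs
  refine ⟨hfill, ?_⟩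
  obtain ⟨_ | ⟨c, l, v, r⟩, lo, hi, trail, count⟩ := s
  · have hroot := Trail.Fits.rootOrdered ht.1 hs (Walker.between_of_dist_eq_zero hs hd)
    have hord := (Path.Ordered.fill.1 (hfill.symm ▸ ht.1)).1
    rw [Path.rootOrdered_iff hord] at hroot
    simp only [cmpLT_compare_iff] at hroot
    rw [← hfill, ← mem_toList]
    simp only [Path.fill_toList, Path.withList]
    intro hmem
    simp only [toList_nil, List.append_nil, List.mem_append] at hmem
    rcases hmem with hmem | hmem
    · exact (hroot.1 _ hmem).false
    · exact (hroot.2 _ hmem).false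
  · exact (Walker.dist_eq_zero_iff_of_node ht.1 hs rfl).1 hd

theorem isInsertResult_insertNew (ht : IsRedBlack t) {path : RBNode.Path K}
    (hz : ReachesTarget t x (nil, path)) :
    IsInsertResult t x (path.ins (node red nil x nil)) := by
  obtain ⟨s, hs, hd, hzs⟩ := hz
  obtain ⟨hf, rfl⟩ := Prod.mk.inj hzs
  have hfill : s.trail.path.fill s.focus = t := Trail.Fits.fill_path hs
  rw [← hf] at hfill
  have hroot := Trail.Fits.rootOrdered ht.1 hs (Walker.between_of_dist_eq_zero hs hd)
  have hord := (Path.Ordered.fill.1 (hfill.symm ▸ ht.1)).1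
  obtain ⟨n₀, hbal⟩ := ht.2
  obtain ⟨c, n, hp, hnil⟩ := balanced_of_balanced_fill (hfill.symm ▸ hbal)
  cases hnil
  refine ⟨⟨hord.insertNew hroot, hp.insertNew⟩, fun y => ?_⟩
  rw [← hfill, ← mem_toList, ← mem_toList]
  simp [Path.withList, or_comm, or_left_comm]

theorem isDeleteResult_del (ht : IsRedBlack t) {path : RBNode.Path K} {c : RBColor}
    {a b : RBNode K} {v : K} (hz : IsSearchResult t x (node c a v b, path)) :
    IsDeleteResult t x (path.del (a.append b) c) := by
  obtain ⟨hfill, hv⟩ := hz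
  obtain rfl : v = x := hv
  obtain ⟨hord, ⟨av, vb, ha, hb⟩, hv, hpa, hpb⟩ := Path.Ordered.fill.1 (hfill.symm ▸ ht.1)
  obtain ⟨n₀, hbal⟩ := ht.2
  obtain ⟨c', n, hp, hs⟩ := balanced_of_balanced_fill (hfill.symm ▸ hbal)
  refine ⟨⟨hord.del (ha.append av vb hb) (hpa.append hpb), ?_⟩, fun y => ?_⟩
  · cases hs with
    | red ha hb => exact hp.del ((ha.append hb).of_false (· rfl rfl)) nofun
    | black ha hb => exact hp.del ⟨_, rfl, (ha.append hb).imp fun _ => ⟨⟩⟩ nofun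
  · rw [Path.rootOrdered_iff hord] at hv
    simp only [All_def, ← mem_toList, cmpLT_compare_iff] at av vb hv
    rw [← hfill, ← mem_toList, ← mem_toList, del_toList, append_toList]
    simp only [Path.fill_toList, Path.withList, toList_node, List.mem_append, List.mem_cons]
    have h₁ := hv.1 y
    have h₂ := hv.2 y
    have h₃ := av y
    have h₄ := vb y
    constructor
    · intro h
      refine ⟨by tauto, ?_⟩
      rintro rfl
      simp only [lt_irrefl, imp_false] at h₁ h₂ h₃ h₄
      tauto
    · tauto

end Correctness

/-! ### Running time and error probability of the operations -/

section Operations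

variable {K : Type u} [LinearOrder K] {t : RBNode K} {x : K}

theorem insert_ensures (ht : t.Ordered compare) (r c L : ℕ) :
    (insert r c L t x).Ensures fun _ n =>
      n ≤ c * (2 * leftHeight t + L) * (5 * r + 6) + 5 * t.depth + 4 := by
  refine (walk_ensures ht r c L).bind fun z n hz => ?_
  have hlen := depth_add_pathLength_le z.2 z.1
  rw [hz.1] at hlen
  have hn := hz.2
  obtain ⟨_ | ⟨col, a, v, b⟩, path⟩ := z
  · exact (rebalanceInsert_ensures path _).mono fun _ m hm => by simp only at hlen; omega
  · exact (fill_ensures path _).mono fun _ m hm => by simp only at hlen; omega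

theorem delete_ensures (ht : t.Ordered compare) (r c L : ℕ) :
    (delete r c L t x).Ensures fun _ n =>
      n ≤ c * (2 * leftHeight t + L) * (5 * r + 6) + 5 * t.depth + 4 := by
  refine (walk_ensures ht r c L).bind fun z n hz => ?_
  have hlen := depth_add_pathLength_le z.2 z.1
  rw [hz.1] at hlen
  have hn := hz.2
  obtain ⟨_ | ⟨col, a, v, b⟩, path⟩ := z
  · exact (fill_ensures path _).mono fun _ m hm => by simp only at hlen; omega
  · refine (join_ensures a b).bind fun s k hs => ?_
    refine (rebalanceDelete_ensures path _ _).mono fun _ m hm => ?_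
    simp only [depth] at hlen
    omega

variable {p : ℝ} {O : NoisyCompare K p} {r c L : ℕ} {η : ℝ}

theorem insert_errs (ht : IsRedBlack t) (h : (walk r c L t x).Errs O η (ReachesTarget t x)) :
    (insert r c L t x).Errs O η (IsInsertResult t x) := by
  refine (h.bind le_rfl fun z hz => Prog.Ensures.errs ?_).mono (add_zero η).le fun _ => id
  have hres := isSearchResult_of_reachesTarget ht hz
  obtain ⟨_ | ⟨col, a, v, b⟩, path⟩ := z
  · refine (rebalanceInsert_ensures path _).mono fun t' m hm => ?_
    rw [hm.1]
    exact isInsertResult_insertNew ht hz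
  · refine (fill_ensures path _).mono fun t' m hm => ?_
    obtain ⟨hfill, hv⟩ := hres
    obtain rfl : v = x := hv
    obtain rfl : t' = t := hm.1.trans hfill
    refine ⟨ht, fun y => ⟨.inl, fun hy => hy.elim id ?_⟩⟩
    rintro rfl
    rw [← hfill, ← mem_toList]
    simp [Path.withList]

theorem delete_errs (ht : IsRedBlack t) (h : (walk r c L t x).Errs O η (ReachesTarget t x)) :
    (delete r c L t x).Errs O η (IsDeleteResult t x) := by
  refine (h.bind le_rfl fun z hz => Prog.Ensures.errs ?_).mono (add_zero η).le fun _ => id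
  have hres := isSearchResult_of_reachesTarget ht hz
  obtain ⟨_ | ⟨col, a, v, b⟩, path⟩ := z
  · refine (fill_ensures path _).mono fun t' m hm => ?_
    obtain rfl : t' = t := hm.1.trans hres.1
    exact ⟨ht, fun y => ⟨fun hy => ⟨hy, fun hyx => hres.2 (hyx ▸ hy)⟩, And.left⟩⟩
  · refine (join_ensures a b).bind fun s k hs => ?_
    refine (rebalanceDelete_ensures path _ _).mono fun t' m hm => ?_
    rw [hm.1, hs.1]
    exact isDeleteResult_del ht hres

/-- The bounds of the three operations for a fixed number of repetitions of the comparisons. -/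
theorem operationsWithin_of_boosted_errs (ht : IsRedBlack t) (hη : 0 ≤ η) (hη' : η ≤ 1 / 80)
    (h : ∀ a b, (boosted r a b).Errs O η (· = compare a b)) {T ε : ℝ}
    (hT : ((2 * (2 * leftHeight t + ⌈Real.log (1 / ε)⌉₊) * (5 * r + 6) + 5 * t.depth + 4 : ℕ) : ℝ)
      ≤ T) (hε : (1 / 4) ^ ⌈Real.log (1 / ε)⌉₊ ≤ ε) :
    OperationsWithin O r 2 t x T ε := by
  obtain ⟨n, hbal⟩ := ht.2
  have hwalk : (walk r 2 ⌈Real.log (1 / ε)⌉₊ t x).Errs O ε (ReachesTarget t x) :=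
    (walk_errs ht.1 hbal hη hη' h _).mono hε fun _ => id
  have htime : ∀ m : ℕ,
      m ≤ 2 * (2 * leftHeight t + ⌈Real.log (1 / ε)⌉₊) * (5 * r + 6) + 5 * t.depth + 4 →
        (m : ℝ) ≤ T := fun m hm => (Nat.cast_le.2 hm).trans hT
  refine ⟨runsWithin_of_ensures_of_errs ?_ ?_, runsWithin_of_ensures_of_errs ?_ ?_,
    runsWithin_of_ensures_of_errs ?_ ?_⟩
  · exact (walk_ensures ht.1 r 2 _).mono fun z m hz => htime m (by omega)
  · exact hwalk.mono le_rfl fun z hz => isSearchResult_of_reachesTarget ht hz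
  · exact (insert_ensures ht.1 r 2 _).mono fun _ m hm => htime m hm
  · exact insert_errs ht hwalk
  · exact (delete_ensures ht.1 r 2 _).mono fun _ m hm => htime m hm
  · exact delete_errs ht hwalk

end Operations

theorem one_quarter_pow_ceil_log_le {ε : ℝ} (hε : 0 < ε) :
    (1 / 4 : ℝ) ^ ⌈Real.log (1 / ε)⌉₊ ≤ ε := by
  set L := ⌈Real.log (1 / ε)⌉₊ with hL
  have h₁ : Real.log (1 / ε) ≤ L := Nat.le_ceil _
  have h₂ : (1 / 4 : ℝ) ≤ Real.exp (-1) := by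
    rw [Real.exp_neg, one_div]
    exact inv_anti₀ (Real.exp_pos 1) (Real.exp_one_lt_d9.le.trans (by norm_num))
  calc (1 / 4 : ℝ) ^ L ≤ Real.exp (-1) ^ L := by gcongr
    _ = Real.exp (-L) := by rw [← Real.exp_nat_mul]; ring_nf
    _ ≤ Real.exp (Real.log ε) := by
      refine Real.exp_le_exp.2 ?_
      rw [one_div, Real.log_inv] at h₁
      linarith
    _ = ε := Real.exp_log hε

/-- The depth of a red-black tree is at most `2 * log₂ (n + 1)`, and `n + 1 ≤ max n 1 / ε`.  With
`ℓ = log (max n 1 / ε) ≥ log 2 > 1 / 2` this bounds the depth by `4 * ℓ`, the number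
`⌈log (1 / ε)⌉` by `3 * ℓ` and `1` by `2 * ℓ`, so that the time is at most
`22 * ℓ * (5 * r + 6) + 28 * ℓ = (110 * r + 160) * ℓ`. -/
theorem time_le_mul_log {K : Type u} {t : RBNode K} {n : ℕ} (hbal : t.Balanced black n) (r : ℕ)
    {ε : ℝ} (hε : 0 < ε) (hε' : ε ≤ 1 / 2) :
    ((2 * (2 * leftHeight t + ⌈Real.log (1 / ε)⌉₊) * (5 * r + 6) + 5 * t.depth + 4 : ℕ) : ℝ) ≤
      (110 * r + 160) * Real.log (max (t.size : ℝ) 1 / ε) := by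
  set ℓ := Real.log (max (t.size : ℝ) 1 / ε) with hℓ
  have hN : (1 : ℝ) ≤ max (t.size : ℝ) 1 := le_max_right _ _
  have hinv : 2 ≤ 1 / ε := by
    rw [le_div_iff₀ hε]; linarith
  have hNε : 1 / ε ≤ max (t.size : ℝ) 1 / ε := by gcongr
  have hlog2 : (1 / 2 : ℝ) < Real.log 2 := by linarith [Real.log_two_gt_d9]
  have hℓ₂ : Real.log 2 ≤ ℓ := Real.log_le_log two_pos (hinv.trans hNε)
  have hL : (⌈Real.log (1 / ε)⌉₊ : ℝ) ≤ 3 * ℓ := by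
    have h₁ := Nat.ceil_lt_add_one (Real.log_nonneg (one_le_two.trans hinv))
    have h₂ : Real.log (1 / ε) ≤ ℓ := Real.log_le_log (by positivity) hNε
    linarith
  have hdepth : (t.depth : ℝ) ≤ 4 * ℓ := by
    have h₁ : (t.depth : ℝ) ≤ 2 * ((t.size + 1).log2 : ℕ) := by exact_mod_cast hbal.depth_bound
    have h₂ : ((t.size + 1).log2 : ℝ) * Real.log 2 ≤ ℓ := by
      rw [← Real.log_pow]
      refine Real.log_le_log (by positivity) ?_
      have h₃ : ((2 ^ (t.size + 1).log2 : ℕ) : ℝ) ≤ ((t.size + 1 : ℕ) : ℝ) :=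
        Nat.cast_le.2 (Nat.log2_self_le (Nat.succ_ne_zero _))
      push_cast at h₃
      have h₄ : max (t.size : ℝ) 1 * 2 ≤ max (t.size : ℝ) 1 / ε := by
        rw [div_eq_mul_one_div]
        gcongr
      linarith [le_max_left (t.size : ℝ) 1]
    have h₅ : ((t.size + 1).log2 : ℝ) * (1 / 2) ≤ ((t.size + 1).log2 : ℝ) * Real.log 2 := by
      gcongr
    linarith
  have hleft : (leftHeight t : ℝ) ≤ 4 * ℓ := (Nat.cast_le.2 (leftHeight_le_depth t)).trans hdepth
  have hr : (0 : ℝ) ≤ r := r.cast_nonneg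
  push_cast
  have hsteps : 2 * (2 * (leftHeight t : ℝ) + ⌈Real.log (1 / ε)⌉₊) * (5 * r + 6) ≤
      2 * (11 * ℓ) * (5 * r + 6) := by
    gcongr
    linarith
  linarith

theorem _root_.Polynomial.exists_eval_natCast_le_pow (P : Polynomial ℝ) :
    ∃ k : ℕ, ∀ n : ℕ, 2 ≤ n → P.eval (n : ℝ) ≤ (n : ℝ) ^ k := by
  obtain ⟨j, hj⟩ := pow_unbounded_of_one_lt (∑ i ∈ Finset.range (P.natDegree + 1), |P.coeff i|)
    (one_lt_two : (1 : ℝ) < 2)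
  refine ⟨j + P.natDegree, fun n hn => ?_⟩
  have hn' : (2 : ℝ) ≤ n := by exact_mod_cast hn
  rw [Polynomial.eval_eq_sum_range, pow_add]
  calc ∑ i ∈ Finset.range (P.natDegree + 1), P.coeff i * (n : ℝ) ^ i
      ≤ ∑ i ∈ Finset.range (P.natDegree + 1), |P.coeff i| * (n : ℝ) ^ P.natDegree := by
        refine Finset.sum_le_sum fun i hi => ?_
        refine mul_le_mul (le_abs_self _) ?_ (by positivity) (abs_nonneg _)
        exact pow_le_pow_right₀ (by linarith) (Finset.mem_range_succ_iff.1 hi)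
    _ = (∑ i ∈ Finset.range (P.natDegree + 1), |P.coeff i|) * (n : ℝ) ^ P.natDegree := by
        rw [Finset.sum_mul]
    _ ≤ (n : ℝ) ^ j * (n : ℝ) ^ P.natDegree := by
        gcongr
        exact hj.le.trans (by gcongr)

theorem OperationsWithin.mono {K : Type u} [LinearOrder K] {p : ℝ} {O : NoisyCompare K p}
    {r c : ℕ} {t : RBNode K} {x : K} {T T' ε : ℝ} (h : OperationsWithin O r c t x T ε)
    (hT : T ≤ T') : OperationsWithin O r c t x T' ε :=
  ⟨⟨fun z hz => (h.1.1 z hz).trans hT, h.1.2⟩, ⟨fun z hz => (h.2.1.1 z hz).trans hT, h.2.1.2⟩,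
    ⟨fun z hz => (h.2.2.1 z hz).trans hT, h.2.2.2⟩⟩

end NoisyTree

theorem theorem2 (δ : ℝ) (hδ_pos : 0 < δ) (hδ_lt : δ < 1 / 2) :
    ∃ r c : ℕ,
      (∃ C : ℝ, ∀ (K : Type u) [LinearOrder K] (p : ℝ), p < 1 / 2 - δ →
        ∀ (O : NoisyTree.NoisyCompare K p) (t : RBTree.RBNode K), NoisyTree.IsRedBlack t →
          ∀ (x : K) (ε : ℝ), 0 < ε → ε ≤ 1 / 2 →
            NoisyTree.OperationsWithin O r c t x
              (C * Real.log (max (t.size : ℝ) 1 / ε)) ε) ∧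
      (∀ P : Polynomial ℝ, ∃ C : ℝ, ∀ (K : Type u) [LinearOrder K] (p : ℝ), p < 1 / 2 - δ →
        ∀ (O : NoisyTree.NoisyCompare K p) (t : RBTree.RBNode K), NoisyTree.IsRedBlack t →
          2 ≤ t.size → 2 ≤ P.eval (t.size : ℝ) →
            ∀ x : K,
              NoisyTree.OperationsWithin O r c t x
                (C * Real.log (t.size : ℝ)) (1 / P.eval (t.size : ℝ))) := by
  have hκ₀ : 0 ≤ 1 - 2 * δ ^ 2 := by nlinarith
  obtain ⟨r, hr⟩ := exists_pow_lt_of_lt_one (by norm_num : (0 : ℝ) < 1 / 80)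
    (by nlinarith : 1 - 2 * δ ^ 2 < 1)
  have main : ∀ (K : Type u) [LinearOrder K] (p : ℝ), p < 1 / 2 - δ →
      ∀ (O : NoisyTree.NoisyCompare K p) (t : RBTree.RBNode K), NoisyTree.IsRedBlack t →
        ∀ (x : K) (ε : ℝ), 0 < ε → ε ≤ 1 / 2 →
          NoisyTree.OperationsWithin O r 2 t x
            ((110 * r + 160) * Real.log (max (t.size : ℝ) 1 / ε)) ε := by
    intro K _ p hp O t ht x ε hε hε'
    obtain ⟨n, hbal⟩ := ht.2
    exact NoisyTree.operationsWithin_of_boosted_errs ht (pow_nonneg hκ₀ r) hr.le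
      (NoisyTree.boosted_errs hδ_pos hδ_lt hp r) (NoisyTree.time_le_mul_log hbal r hε hε')
      (NoisyTree.one_quarter_pow_ceil_log_le hε)
  refine ⟨r, 2, ⟨110 * r + 160, main⟩, fun P => ?_⟩
  obtain ⟨k, hk⟩ := P.exists_eval_natCast_le_pow
  refine ⟨(110 * r + 160) * (1 + k), fun K _ p hp O t ht hsize hP x => ?_⟩
  have hn : (2 : ℝ) ≤ t.size := by exact_mod_cast hsize
  have hP₀ : 0 < P.eval (t.size : ℝ) := by linarith
  refine (main K p hp O t ht x (1 / P.eval (t.size : ℝ)) (by positivity)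
    (one_div_le_one_div_of_le two_pos hP)).mono ?_
  rw [max_eq_left (by linarith), div_div_eq_mul_div, div_one,
    Real.log_mul (by positivity) hP₀.ne', mul_assoc, one_add_mul, ← Real.log_pow]
  have hlog := Real.log_le_log hP₀ (hk t.size hsize)
  gcongr
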